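/- All graphs are finite, simple and undirected. For a graph $G$ and a set $S\subseteq V(G)$ with $|S|\ge 2$, a tree connecting $S$ is a subgraph of $G$ that is a tree and whose vertex set contains $S$; let $\lambda(S)$ be the maximum number of pairwise edge-disjoint trees connecting $S$ in $G$. For a graph $G$ of order at least $3$ let $\lambda_3(G)=\min\{\lambda(S): S\subseteq V(G),\ |S|=3\}$ (so $\lambda_3(G)=0$ if $G$ is disconnected). For $n\ge 3$ and $0\le \ell\le n-2$ let $g(n,3,\ell)$ be the minimum number of edges of a graph $G$ of order $n$ with $\lambda_3(G)=\ell$. **Theorem.** Let $n\ge 3$ be an integer. Then 1. $g(n,3,n-2)=\binom n2-1$; 2. $g(n,3,n-3)=\binom n2-\left\lfloor\frac{n+3}{2}\right\rfloor$; 3. $g(n,3,1)=n-1$; 4. if $n\ge 11$ and $1\le \ell\le n-4$, then $g(n,3,\ell)\ge \left\lceil \frac{\ell(\ell+1)}{2\ell+1}\,n\right\rceil$. Moreover, the bound in (4) is sharp: for every $\ell\ge 1$, the complete bipartite graph $K_{\ell,\ell+1}$, of order $n=2\ell+1$, satisfies $\lambda_3(K_{\ell,\ell+1})=\ell$ and $|E(K_{\ell,\ell+1})|=\left\lceil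 \frac{\ell(\ell+1)}{2\ell+1}\,n\right\rceil$, and $g(2\ell+1,3,\ell)=\left\lceil \frac{\ell(\ell+1)}{2\ell+1}(2\ell+1)\right\rceil$. (For $\ell\ge 5$ the pair $(n,\ell)=(2\ell+1,\ell)$ lies in the range of (4).) -/

import Mathlib

namespace GenEdgeConn

/-- `T` is an `S`-Steiner tree of `G`: a subgraph of `G` that is a tree whose vertex set
contains `S`. -/
def IsSteinerTree {V : Type*} (G : SimpleGraph V) (S : Finset V) (T : G.Subgraph) : Prop :=
  T.coe.IsTree ∧ (S : Set V) ⊆ T.verts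

/-- There are `m` pairwise edge-disjoint trees connecting `S` in `G`. -/
def HasEdgeDisjointTrees {V : Type*} (G : SimpleGraph V) (S : Finset V) (m : ℕ) : Prop :=
  ∃ T : Fin m → G.Subgraph, (∀ i, IsSteinerTree G S (T i)) ∧
    Pairwise fun i j => Disjoint (T i).edgeSet (T j).edgeSet

/-- The generalized local edge-connectivity `λ(S)`: the maximum number of pairwise edge-disjoint
trees connecting `S` in `G`.  (For a finite graph and `2 ≤ |S|` every such tree has an edge, so
the number is bounded by the number of edges and the supremum is a maximum.) -/
noncomputable def localEdgeConn {V : Type*} (G : SimpleGraph V) (S : Finset V) : ℕ :=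
  sSup {m : ℕ | HasEdgeDisjointTrees G S m}

/-- The generalized `k`-edge-connectivity `λ_k(G) = min {λ(S) : |S| = k}`, for
`2 ≤ k ≤ |V(G)|`.  (For a disconnected `G` this is `0`: a `k`-set `S` that meets two components
has `λ(S) = 0`.) -/
noncomputable def genEdgeConn {V : Type*} (G : SimpleGraph V) (k : ℕ) : ℕ :=
  sInf {m : ℕ | ∃ S : Finset V, S.card = k ∧ localEdgeConn G S = m}

/-- `g(n,k,ℓ)`: the minimum number of edges of a graph `G` of order `n` with `λ_k(G) = ℓ`. -/
noncomputable def minSize (n k ℓ : ℕ) : ℕ :=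
  sInf {e : ℕ | ∃ G : SimpleGraph (Fin n), genEdgeConn G k = ℓ ∧ G.edgeSet.ncard = e}

end GenEdgeConn

/-! ### Edge-disjoint trees as edge-disjoint connecting subgraphs -/

namespace GenEdgeConn
open SimpleGraph

/-! Trees connecting `S` may be traded for edge-disjoint spanning subgraphs in which `S` lies in one
component, so upper bounds come from edge weights and lower bounds from edge colourings.

Upper bounds on the number of trees: if every connecting subgraph has weight at least `k`, then `m`
disjoint ones need total weight `m * k` (`mul_le_sum`). Weighting the edges at two adjacent vertices
(`adj_bound`) shows that vertices of degree `ℓ` are independent when `λ_3 ≥ ℓ`; since all degrees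
are at least `ℓ`, double counting gives `ℓ(ℓ+1)n ≤ (2ℓ+1)e` (`le_edges_of_le_genEdgeConn`).
Weighting the edges at a triple (`triple_bound`) limits the complement degrees of any three
vertices, so the complement has at most one edge when `λ_3 = n-2` and at most `(n+3)/2` when `λ_3 =
n-3`.

Extremal graphs: `K_n` minus an edge, `K_n` minus a triangle and a matching, any tree, and
`K_{ℓ,ℓ+1}`. In the two dense graphs the trees for `{a, b, c}` are stars centred at the other
vertices. A star that misses a leaf because of a deleted edge is repaired with edges inside the
triple, or rerouted through another outer vertex. In `K_{ℓ,ℓ+1}` explicit colourings give `ℓ` trees,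
and the edge count excludes `ℓ+1`.

Each lower bound on `minSize` also needs some graph attaining the value; it is found by deleting
edges from `K_n` minus an edge, as each deletion lowers `λ_3` by at most one. -/

theorem hasEdgeDisjointTrees_of_subgraphs {V ι : Type*} {G : SimpleGraph V} {S : Finset V}
    (hS : S.Nonempty) (I : Finset ι) (H : ι → SimpleGraph V) (hG : ∀ i ∈ I, H i ≤ G)
    (hd : ∀ i ∈ I, ∀ j ∈ I, ∀ u v, (H i).Adj u v → (H j).Adj u v → i = j)
    (hr : ∀ i ∈ I, ∀ u ∈ S, ∀ v ∈ S, (H i).Reachable u v) :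
    HasEdgeDisjointTrees G S I.card := by
  obtain ⟨s, hs⟩ := hS
  have key : ∀ i : I, ∃ T : G.Subgraph, IsSteinerTree G S T ∧
      ∀ u v, T.Adj u v → (H i).Adj u v := by
    intro i
    -- The component of `s` contains all of `S`; a spanning tree of it is the required tree.
    let C := (H i).connectedComponentMk s
    obtain ⟨T, hT, hTt⟩ := C.connected_toSimpleGraph.exists_isTree_le
    refine ⟨⟨C.supp, fun u v => ∃ hu hv, T.Adj ⟨u, hu⟩ ⟨v, hv⟩, ?_, ?_,
      ⟨?_⟩⟩, ⟨?_, ?_⟩, ?_⟩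
    · rintro u v ⟨hu, hv, h⟩
      exact hG i i.2 (hT h)
    · rintro u v ⟨hu, hv, h⟩
      exact hu
    · rintro u v ⟨hu, hv, h⟩
      exact ⟨hv, hu, h.symm⟩
    · refine (Iso.isTree_iff (G' := T) ⟨Equiv.refl _, fun {u v} => ?_⟩).2 hTt
      exact ⟨fun h => ⟨u.2, v.2, h⟩, fun ⟨_, _, h⟩ => h⟩
    · intro u hu
      exact ConnectedComponent.sound (hr i i.2 u hu s hs)
    · rintro u v ⟨hu, hv, h⟩
      exact hT h
  choose T hT hTH using key
  refine ⟨fun k => T (I.equivFin.symm k), fun k => hT _, fun k l hkl => ?_⟩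
  refine Set.disjoint_left.2 fun e he he' => ?_
  induction e using Sym2.ind with
  | _ u v =>
    have h := hd _ (I.equivFin.symm k).2 _ (I.equivFin.symm l).2 u v
      (hTH _ _ _ he) (hTH _ _ _ he')
    exact hkl (I.equivFin.symm.injective (Subtype.ext h))

theorem HasEdgeDisjointTrees.exists_subgraphs {V : Type*} {G : SimpleGraph V} {S : Finset V}
    {m : ℕ} (h : HasEdgeDisjointTrees G S m) :
    ∃ H : Fin m → SimpleGraph V, (∀ i, H i ≤ G) ∧
      (∀ i j u v, (H i).Adj u v → (H j).Adj u v → i = j) ∧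
      ∀ i, ∀ u ∈ S, ∀ v ∈ S, (H i).Reachable u v := by
  obtain ⟨T, hT, hd⟩ := h
  refine ⟨fun i => (T i).spanningCoe, fun i => (T i).spanningCoe_le, ?_, ?_⟩
  · intro i j u v hu hv
    by_contra hij
    exact Set.disjoint_left.1 (hd hij) (show s(u, v) ∈ (T i).edgeSet from hu) hv
  · intro i u hu v hv
    have := (hT i).1.1.preconnected ⟨u, (hT i).2 hu⟩ ⟨v, (hT i).2 hv⟩
    exact this.map ⟨Subtype.val, fun h => h⟩

/-- The subgraph of `G` formed by the edges that `col` maps to `i`. -/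
def colorClass {V ι : Type*} (G : SimpleGraph V) (col : Sym2 V → ι) (i : ι) : SimpleGraph V where
  Adj u v := G.Adj u v ∧ col s(u, v) = i
  symm := ⟨fun u v h => ⟨h.1.symm, by rw [Sym2.eq_swap]; exact h.2⟩⟩
  loopless := ⟨fun u h => G.loopless.irrefl u h.1⟩

/-- Colour classes are edge-disjoint by construction, so only reachability within each class remains
to be checked. -/
theorem hasEdgeDisjointTrees_of_coloring {V ι : Type*} {G : SimpleGraph V} {a b c : V}
    [DecidableEq V] (I : Finset ι) (col : Sym2 V → ι)
    (h : ∀ i ∈ I, (colorClass G col i).Reachable a b ∧ (colorClass G col i).Reachable a c) :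
    HasEdgeDisjointTrees G {a, b, c} I.card := by
  refine hasEdgeDisjointTrees_of_subgraphs ⟨a, by simp⟩ I (colorClass G col)
    (fun i _ u v h => h.1) (fun i _ j _ u v h h' => h.2.symm.trans h'.2) ?_
  intro i hi
  have hs : ∀ u ∈ ({a, b, c} : Finset V), (colorClass G col i).Reachable a u := by
    intro u hu
    simp only [Finset.mem_insert, Finset.mem_singleton] at hu
    obtain rfl | rfl | rfl := hu
    · exact Reachable.refl _
    · exact (h i hi).1
    · exact (h i hi).2
  exact fun u hu v hv => (hs u hu).symm.trans (hs v hv)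

theorem HasEdgeDisjointTrees.mono {V : Type*} {G G' : SimpleGraph V} {S : Finset V} {m k : ℕ}
    (h : HasEdgeDisjointTrees G S m) (hG : G ≤ G') (hk : k ≤ m) (hS : S.Nonempty) :
    HasEdgeDisjointTrees G' S k := by
  obtain ⟨H, h1, h2, h3⟩ := h.exists_subgraphs
  have := hasEdgeDisjointTrees_of_subgraphs hS Finset.univ (fun i : Fin k => H (Fin.castLE hk i))
    (fun i _ => (h1 _).trans hG)
    (fun i _ j _ u v h h' => Fin.castLE_injective hk (h2 _ _ u v h h')) (fun i _ => h3 _)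
  simpa using this

theorem HasEdgeDisjointTrees.map {V W : Type*} {G : SimpleGraph V} {G' : SimpleGraph W}
    (e : G ≃g G') {S : Finset W} {m : ℕ} (hS : S.Nonempty)
    (h : HasEdgeDisjointTrees G (S.map e.symm.toEquiv.toEmbedding) m) :
    HasEdgeDisjointTrees G' S m := by
  obtain ⟨H, h1, h2, h3⟩ := h.exists_subgraphs
  have := hasEdgeDisjointTrees_of_subgraphs (G := G') hS Finset.univ
    (fun i => (H i).comap e.symm)
    (fun i _ u v h => e.symm.map_adj_iff.1 (h1 i h))
    (fun i _ j _ u v h h' => h2 _ _ _ _ h h') ?_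
  · simpa using this
  · intro i _ u hu v hv
    have := h3 i (e.symm u) (Finset.mem_map_of_mem _ hu) (e.symm v)
      (Finset.mem_map_of_mem _ hv)
    have h' := this.map (G' := (H i).comap e.symm) ⟨e, fun {a b} h => by simpa using h⟩
    simpa using h'

/-- At most one of the disjoint subgraphs uses the edge; discarding that one leaves the others
intact. -/
theorem HasEdgeDisjointTrees.deleteEdge {V : Type*} {G : SimpleGraph V} {S : Finset V} {m : ℕ}
    (h : HasEdgeDisjointTrees G S (m + 1)) (hS : S.Nonempty) (x y : V) :
    HasEdgeDisjointTrees (G.deleteEdges {s(x, y)}) S m := by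
  obtain ⟨H, h1, h2, h3⟩ := h.exists_subgraphs
  obtain ⟨k, hk⟩ : ∃ k, ∀ i, i ≠ k → ¬ (H i).Adj x y := by
    by_cases h : ∃ k, (H k).Adj x y
    · obtain ⟨k, hk⟩ := h
      exact ⟨k, fun i hi h => hi (h2 _ _ _ _ h hk)⟩
    · push Not at h
      exact ⟨0, fun i _ => h i⟩
  have := hasEdgeDisjointTrees_of_subgraphs (G := G.deleteEdges {s(x, y)}) hS Finset.univ
    (fun i => H (k.succAbove i)) ?_
    (fun i _ j _ u v h h' => Fin.succAbove_right_injective (h2 _ _ u v h h')) (fun i _ => h3 _)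
  · simpa using this
  · intro i _ u v huv
    rw [deleteEdges_adj]
    refine ⟨h1 _ huv, fun h => ?_⟩
    have hn := hk _ (Fin.succAbove_ne k i)
    rw [← mem_edgeSet, ← (h : s(u, v) = s(x, y))] at hn
    exact hn huv

/-! ### Weight bounds, and the invariants as thresholds -/

/-- A weight on ordered pairs that gives every subgraph connecting `S` total weight at least `k`
bounds the number of edge-disjoint trees connecting `S`. -/
theorem HasEdgeDisjointTrees.mul_le_sum {V : Type*} {G : SimpleGraph V} {S : Finset V} {m : ℕ}
    (h : HasEdgeDisjointTrees G S m) (P : Finset (V × V)) (w : V × V → ℕ) (k : ℕ)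
    [DecidableRel G.Adj]
    (hk : ∀ H : SimpleGraph V, ∀ [DecidableRel H.Adj], (∀ u ∈ S, ∀ v ∈ S, H.Reachable u v) →
      k ≤ ∑ p ∈ P, if H.Adj p.1 p.2 then w p else 0) :
    m * k ≤ ∑ p ∈ P, if G.Adj p.1 p.2 then w p else 0 := by
  classical
  obtain ⟨H, h1, h2, h3⟩ := h.exists_subgraphs
  calc m * k = ∑ i : Fin m, k := by simp
    _ ≤ ∑ i : Fin m, ∑ p ∈ P, if (H i).Adj p.1 p.2 then w p else 0 :=
        Finset.sum_le_sum fun i _ => hk _ (h3 i)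
    _ = ∑ p ∈ P, ∑ i : Fin m, if (H i).Adj p.1 p.2 then w p else 0 := Finset.sum_comm
    _ ≤ _ := ?_
  refine Finset.sum_le_sum fun p _ => ?_
  by_cases hp : ∃ i, (H i).Adj p.1 p.2
  · obtain ⟨i, hi⟩ := hp
    -- By disjointness exactly one subgraph contains this pair, so its weight is counted once.
    rw [if_pos (h1 i hi), Finset.sum_eq_single i, if_pos hi]
    · exact fun j _ hj => if_neg fun h => hj (h2 _ _ _ _ h hi)
    · simp
  · push Not at hp
    simp [hp]

theorem exists_adj_of_reachable {V : Type*} {H : SimpleGraph V} {u v : V}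
    (h : H.Reachable u v) (A : Set V) (hu : u ∈ A) (hv : v ∉ A) :
    ∃ x ∈ A, ∃ y ∉ A, H.Adj x y := by
  obtain ⟨p⟩ := h
  obtain ⟨d, -, h1, h2⟩ := p.exists_boundary_dart A hu hv
  exact ⟨_, h1, _, h2, d.adj⟩

open Finset

theorem localEdgeConn_bddAbove {V : Type*} [Fintype V] {G : SimpleGraph V} {S : Finset V}
    (hS : 1 < S.card) : BddAbove {m : ℕ | HasEdgeDisjointTrees G S m} := by
  classical
  obtain ⟨u, hu, v, hv, huv⟩ := one_lt_card.1 hS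
  refine ⟨∑ p ∈ (univ : Finset (V × V)), if G.Adj p.1 p.2 then 1 else 0, fun m hm => ?_⟩
  have := HasEdgeDisjointTrees.mul_le_sum hm univ (fun _ => 1) 1 fun H _ hH => ?_
  · simpa using this
  · obtain ⟨x, -, y, -, hxy⟩ := exists_adj_of_reachable (hH u hu v hv) {u} rfl huv.symm
    calc 1 = if H.Adj x y then 1 else 0 := by simp [hxy]
      _ ≤ _ := single_le_sum (f := fun p : V × V => if H.Adj p.1 p.2 then 1 else 0)
        (fun _ _ => Nat.zero_le _) (mem_univ (x, y))

theorem le_localEdgeConn_iff {V : Type*} [Fintype V] {G : SimpleGraph V} {S : Finset V}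
    (hS : 1 < S.card) {m : ℕ} : m ≤ localEdgeConn G S ↔ HasEdgeDisjointTrees G S m := by
  have hb := localEdgeConn_bddAbove (G := G) hS
  have hne : S.Nonempty := card_pos.1 (by lia)
  have h0 : HasEdgeDisjointTrees G S 0 := ⟨fun i => i.elim0, fun i => i.elim0, fun i => i.elim0⟩
  exact ⟨fun h => (Nat.sSup_mem ⟨0, h0⟩ hb).mono le_rfl h hne, fun h => le_csSup hb h⟩

theorem le_genEdgeConn_iff {V : Type*} [Fintype V] {G : SimpleGraph V} {k : ℕ} (hk : 1 < k)
    (hV : k ≤ Fintype.card V) {m : ℕ} :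
    m ≤ genEdgeConn G k ↔ ∀ S : Finset V, S.card = k → HasEdgeDisjointTrees G S m := by
  constructor
  · intro h S hS
    rw [← le_localEdgeConn_iff (by lia)]
    exact h.trans (Nat.sInf_le ⟨S, hS, rfl⟩)
  · intro h
    obtain ⟨S, -, hS⟩ := exists_subset_card_eq (s := (univ : Finset V)) (by simpa using hV)
    refine le_csInf ⟨_, S, hS, rfl⟩ ?_
    rintro _ ⟨S, hS, rfl⟩
    exact (le_localEdgeConn_iff (by lia)).2 (h S hS)

theorem genEdgeConn_le_of_iso {V W : Type*} [Fintype V] [Fintype W] {G : SimpleGraph V}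
    {G' : SimpleGraph W} (e : G ≃g G') {k : ℕ} (hk : 1 < k) (hV : k ≤ Fintype.card V) :
    genEdgeConn G k ≤ genEdgeConn G' k := by
  rw [le_genEdgeConn_iff hk (by rwa [← Fintype.card_congr e.toEquiv])]
  intro S hS
  refine HasEdgeDisjointTrees.map e (card_pos.1 (by lia)) ?_
  exact (le_genEdgeConn_iff hk hV).1 le_rfl _ (by simpa using hS)

theorem genEdgeConn_congr {V W : Type*} [Fintype V] [Fintype W] {G : SimpleGraph V}
    {G' : SimpleGraph W} (e : G ≃g G') {k : ℕ} (hk : 1 < k) (hV : k ≤ Fintype.card V) :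
    genEdgeConn G k = genEdgeConn G' k :=
  (genEdgeConn_le_of_iso e hk hV).antisymm
    (genEdgeConn_le_of_iso e.symm hk (by rwa [← Fintype.card_congr e.toEquiv]))

theorem genEdgeConn_le_deleteEdge {V : Type*} [Fintype V] (G : SimpleGraph V) {k : ℕ}
    (hk : 1 < k) (hV : k ≤ Fintype.card V) (x y : V) :
    genEdgeConn G k ≤ genEdgeConn (G.deleteEdges {s(x, y)}) k + 1 := by
  rcases h : genEdgeConn G k with _ | m
  · simp
  · rw [add_le_add_iff_right, le_genEdgeConn_iff hk hV]
    exact fun S hS => ((le_genEdgeConn_iff hk hV).1 h.ge S hS).deleteEdge (card_pos.1 (by lia)) x y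

theorem genEdgeConn_bot {V : Type*} [Fintype V] {k : ℕ} (hk : 1 < k) (hV : k ≤ Fintype.card V) :
    genEdgeConn (⊥ : SimpleGraph V) k = 0 := by
  by_contra h
  obtain ⟨S, -, hS⟩ := exists_subset_card_eq (s := (univ : Finset V)) (by simpa using hV)
  obtain ⟨H, h1, -, h3⟩ :=
    ((le_genEdgeConn_iff hk hV).1 (Nat.one_le_iff_ne_zero.2 h) S hS).exists_subgraphs
  obtain ⟨u, hu, v, hv, huv⟩ := one_lt_card.1 (by lia : 1 < S.card)
  obtain ⟨x, -, y, -, hxy⟩ := exists_adj_of_reachable (h3 0 u hu v hv) {u} rfl huv.symm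
  exact h1 0 hxy

/-- Deleting edges one at a time, every value below that of a graph is attained. -/
theorem exists_genEdgeConn_eq {V : Type*} [Fintype V] (G₀ : SimpleGraph V) {k m : ℕ}
    (hk : 1 < k) (hV : k ≤ Fintype.card V) (hm : m ≤ genEdgeConn G₀ k) :
    ∃ G : SimpleGraph V, genEdgeConn G k = m := by
  -- An edge-minimal graph with value at least `m`: one more deletion drops below `m`, and by at
  -- most one.
  obtain ⟨G, hG⟩ := (Set.toFinite {G : SimpleGraph V | m ≤ genEdgeConn G k}).exists_minimal
    ⟨G₀, hm⟩
  refine ⟨G, le_antisymm ?_ hG.prop⟩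
  rcases eq_or_ne G ⊥ with rfl | hne
  · simp [genEdgeConn_bot hk hV]
  · obtain ⟨x, y, hxy⟩ := ne_bot_iff_exists_adj.1 hne
    refine (genEdgeConn_le_deleteEdge G hk hV x y).trans ?_
    by_contra h
    have := hG.le_of_le (show m ≤ genEdgeConn (G.deleteEdges {s(x, y)}) k by lia)
      (deleteEdges_le _)
    simpa using this hxy

theorem minSize_le {n k : ℕ} (G : SimpleGraph (Fin n)) :
    minSize n k (genEdgeConn G k) ≤ G.edgeSet.ncard :=
  Nat.sInf_le ⟨G, rfl, rfl⟩

/-- The existence hypothesis is essential, since the infimum of the empty set is `0`. -/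
theorem le_minSize {n k l b : ℕ} (hne : ∃ G : SimpleGraph (Fin n), genEdgeConn G k = l)
    (h : ∀ G : SimpleGraph (Fin n), genEdgeConn G k = l → b ≤ G.edgeSet.ncard) :
    b ≤ minSize n k l := by
  obtain ⟨G, hG⟩ := hne
  refine le_csInf ⟨_, G, hG, rfl⟩ ?_
  rintro _ ⟨G, hG, rfl⟩
  exact h G hG

/-! ### Degree bounds at pairs and triples -/

theorem card_filter_triple {V : Type*} [DecidableEq V] (H : SimpleGraph V)
    [DecidableRel H.Adj] {a b c : V} (hab : a ≠ b)
    (hac : a ≠ c) (hbc : b ≠ c) (v : V) :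
    #{w ∈ ({a, b, c} : Finset V) | H.Adj v w} =
      (if H.Adj v a then 1 else 0) + (if H.Adj v b then 1 else 0) +
        (if H.Adj v c then 1 else 0) := by
  rw [card_filter, sum_insert (by simp [hab, hac]), sum_insert (by simpa using hbc), sum_singleton,
    add_assoc]

theorem HasEdgeDisjointTrees.le_degree {V : Type*} [Fintype V] {G : SimpleGraph V} [DecidableRel G.Adj]
    {S : Finset V} {m : ℕ} (h : HasEdgeDisjointTrees G S m) {u v : V} (hu : u ∈ S) (hv : v ∈ S) (huv : u ≠ v) :
    m ≤ G.degree u := by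
  have hw : ∀ H : SimpleGraph V, ∀ [DecidableRel H.Adj],
      (∑ p ∈ {u} ×ˢ univ, if H.Adj p.1 p.2 then 1 else 0) = H.degree u := by
    intro H _
    rw [sum_product, sum_singleton, ← card_neighborFinset_eq_degree, neighborFinset_eq_filter,
      card_filter]
  have hm := h.mul_le_sum ({u} ×ˢ univ) (fun _ => 1) 1 fun H _ hH => ?_
  · rw [hw] at hm
    simpa using hm
  · rw [hw]
    obtain ⟨x, rfl, y, -, hxy⟩ := exists_adj_of_reachable (hH u hu v hv) {u} rfl huv.symm
    exact (H.degree_pos_iff_exists_adj x).2 ⟨y, hxy⟩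

section Counting

variable {V : Type*} [Fintype V] [DecidableEq V]

theorem sum_adj_weight (H : SimpleGraph V) [DecidableRel H.Adj] (S : Finset V) (a : V) (s t : ℕ) :
    ∑ w, (if H.Adj a w then (if w ∈ S then s else t) else 0) =
      t * #{w ∈ Sᶜ | H.Adj a w} + s * #{w ∈ S | H.Adj a w} := by
  rw [← sum_add_sum_compl S, add_comm, card_filter, card_filter, mul_sum, mul_sum]
  congr 1
  · exact sum_congr rfl fun w hw => by simp [mem_compl.1 hw]
  · exact sum_congr rfl fun w hw => by simp [hw]

theorem degree_eq_add (H : SimpleGraph V) [DecidableRel H.Adj] (S : Finset V) (a : V) :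
    H.degree a = #{w ∈ Sᶜ | H.Adj a w} + #{w ∈ S | H.Adj a w} := by
  have := sum_adj_weight H S a 1 1
  simp only [ite_self, one_mul] at this
  rw [← this, ← card_neighborFinset_eq_degree, neighborFinset_eq_filter, card_filter]

/-- Up to the choice of weights, a tree connecting the triple uses two inner edges, or one inner and
two outgoing edges, or three outgoing edges. -/
theorem HasEdgeDisjointTrees.triple_bound {G : SimpleGraph V} [DecidableRel G.Adj] {a b c : V}
    (hab : a ≠ b) (hac : a ≠ c) (hbc : b ≠ c) {m : ℕ} (h : HasEdgeDisjointTrees G {a, b, c} m) :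
    6 * m + (if G.Adj a b then 1 else 0) + (if G.Adj a c then 1 else 0) +
      (if G.Adj b c then 1 else 0) ≤ 2 * (G.degree a + G.degree b + G.degree c) := by
  set S : Finset V := {a, b, c} with hS
  have hw : ∀ H : SimpleGraph V, ∀ [DecidableRel H.Adj],
      (∑ p ∈ S ×ˢ univ, if H.Adj p.1 p.2 then (if p.2 ∈ S then 3 else 4) else 0) =
      4 * (#{w ∈ Sᶜ | H.Adj a w} + #{w ∈ Sᶜ | H.Adj b w} + #{w ∈ Sᶜ | H.Adj c w}) +
      6 * ((if H.Adj a b then 1 else 0) + (if H.Adj a c then 1 else 0) +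
        (if H.Adj b c then 1 else 0)) := by
    intro H _
    rw [sum_product, hS, sum_insert (by simp [hab, hac]), sum_insert (by simpa using hbc),
      sum_singleton, sum_adj_weight, sum_adj_weight, sum_adj_weight,
      card_filter_triple H hab hac hbc, card_filter_triple H hab hac hbc,
      card_filter_triple H hab hac hbc]
    simp only [SimpleGraph.irrefl, if_false, H.adj_comm b a, H.adj_comm c a, H.adj_comm c b]
    ring
  -- Inner edges are seen from both ends, so they weigh 6 and outgoing ones 4; the three types of
  -- tree weigh at least 12, 14 and 12.
  have hm := h.mul_le_sum (S ×ˢ univ) (fun p => if p.2 ∈ S then 3 else 4) 12 fun H _ hH => ?_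
  · rw [hw] at hm
    rw [degree_eq_add G S a, degree_eq_add G S b, degree_eq_add G S c, hS,
      card_filter_triple G hab hac hbc, card_filter_triple G hab hac hbc,
      card_filter_triple G hab hac hbc]
    simp only [SimpleGraph.irrefl, if_false, G.adj_comm b a, G.adj_comm c a, G.adj_comm c b]
    rw [hS] at hm
    lia
  · rw [hw]
    have ha : a ∈ S := by simp [hS]
    have hb : b ∈ S := by simp [hS]
    have hc : c ∈ S := by simp [hS]
    have hpos : ∀ x y, H.Adj x y → y ∉ S → 1 ≤ #{w ∈ Sᶜ | H.Adj x w} := fun x y hxy hy =>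
      card_pos.2 ⟨y, by simp [hxy, hy]⟩
    have hmem : ∀ y, y ∈ S ↔ y = a ∨ y = b ∨ y = c := by simp [hS]
    have hdeg : ∀ u ∈ S, ∀ v ∈ S, u ≠ v → 1 ≤ H.degree u := by
      intro u hu v hv huv
      obtain ⟨x, rfl, y, -, hxy⟩ := exists_adj_of_reachable (hH u hu v hv) {u} rfl huv.symm
      exact (H.degree_pos_iff_exists_adj x).2 ⟨y, hxy⟩
    have hcut : ∀ u v w, (∀ y ∈ S, y = u ∨ y = v ∨ y = w) → u ∈ S → w ∈ S → u ≠ w → v ≠ w →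
        1 ≤ #{y ∈ Sᶜ | H.Adj u y} + #{y ∈ Sᶜ | H.Adj v y} + (if H.Adj u w then 1 else 0) +
          (if H.Adj v w then 1 else 0) := by
      intro u v w hS' hu hw huw hvw
      obtain ⟨x, hx, y, hy, hxy⟩ := exists_adj_of_reachable (hH u hu w hw) {u, v} (by simp)
        (by simp [huw.symm, hvw.symm])
      by_cases hyS : y ∈ S
      · obtain rfl | rfl | rfl := hS' y hyS
        · simp at hy
        · simp at hy
        · obtain rfl | rfl := hx
          all_goals
            rw [if_pos hxy]
            lia
      · have := hpos x y hxy hyS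
        obtain rfl | rfl := hx <;> lia
    have h1 := hdeg a ha b hb hab
    have h2 := hdeg b hb a ha hab.symm
    have h3 := hdeg c hc a ha hac.symm
    have h4 := hcut a b c (by simp [hmem]) ha hc hac hbc
    have h5 := hcut a c b (by simp [hmem]) ha hb hab hbc.symm
    have h6 := hcut b c a (by simp [hmem]) hb ha hab.symm hac.symm
    rw [degree_eq_add H S, hS, card_filter_triple H hab hac hbc] at h1 h2 h3
    simp only [SimpleGraph.irrefl, if_false, H.adj_comm b a, H.adj_comm c a, H.adj_comm c b]
      at h1 h2 h3 h4 h5 h6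
    rw [hS] at h4 h5 h6 ⊢
    split_ifs at * <;> lia

/-- Two adjacent vertices cannot both be leaves of a tree that contains a third vertex. -/
theorem HasEdgeDisjointTrees.adj_bound {G : SimpleGraph V} [DecidableRel G.Adj] {S : Finset V}
    {m : ℕ} (h : HasEdgeDisjointTrees G S m) {u v w : V} (hu : u ∈ S) (hv : v ∈ S) (hw : w ∈ S)
    (huv : G.Adj u v) (huw : u ≠ w) (hvw : v ≠ w) : 2 * m + 1 ≤ G.degree u + G.degree v := by
  set P : Finset V := {u, v} with hP
  have hne := huv.ne
  have hf : ∀ H : SimpleGraph V, ∀ [DecidableRel H.Adj], ∀ x,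
      #{y ∈ P | H.Adj x y} = (if H.Adj x u then 1 else 0) + (if H.Adj x v then 1 else 0) := by
    intro H _ x
    rw [card_filter, hP, sum_insert (by simpa using hne), sum_singleton]
  have hW : ∀ H : SimpleGraph V, ∀ [DecidableRel H.Adj],
      (∑ p ∈ P ×ˢ univ, if H.Adj p.1 p.2 then (if p.2 ∈ P then 1 else 2) else 0) =
      2 * (#{w ∈ Pᶜ | H.Adj u w} + #{w ∈ Pᶜ | H.Adj v w} + if H.Adj u v then 1 else 0) := by
    intro H _
    rw [sum_product]
    nth_rw 1 [hP]
    rw [sum_insert (by simpa using hne), sum_singleton, sum_adj_weight, sum_adj_weight, hf, hf]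
    simp only [SimpleGraph.irrefl, if_false, H.adj_comm v u]
    ring
  -- Every edge meeting `{u, v}` weighs 2 in total, and a subgraph joining `u`, `v` and `w` has at
  -- least two such edges.
  have hm := h.mul_le_sum (P ×ˢ univ) (fun p => if p.2 ∈ P then 1 else 2) 4 fun H _ hH => ?_
  · rw [hW, if_pos huv] at hm
    rw [degree_eq_add G P u, degree_eq_add G P v, hf, hf, if_pos huv, if_pos huv.symm]
    lia
  · rw [hW]
    have hdeg : ∀ x ∈ S, x ≠ w → 1 ≤ H.degree x := by
      intro x hx hxw
      obtain ⟨x, rfl, y, -, hxy⟩ := exists_adj_of_reachable (hH x hx w hw) {x} rfl hxw.symm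
      exact (H.degree_pos_iff_exists_adj x).2 ⟨y, hxy⟩
    have h1 := hdeg u hu huw
    have h2 := hdeg v hv hvw
    rw [degree_eq_add H P, hf] at h1 h2
    simp only [SimpleGraph.irrefl, if_false, H.adj_comm v u] at h1 h2
    have h3 : 1 ≤ #{w ∈ Pᶜ | H.Adj u w} + #{w ∈ Pᶜ | H.Adj v w} := by
      obtain ⟨x, hx, y, hy, hxy⟩ := exists_adj_of_reachable (hH u hu w hw) P (by simp [hP])
        (by simp [hP, huw.symm, hvw.symm])
      have hpos : 1 ≤ #{w ∈ Pᶜ | H.Adj x w} := card_pos.2 ⟨y, by simpa [hxy] using hy⟩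
      have hx : x = u ∨ x = v := by simpa [hP] using hx
      obtain rfl | rfl := hx <;> lia
    split_ifs at * <;> lia

end Counting

/-! ### Edge bounds for graphs with large generalized edge-connectivity -/

theorem HasEdgeDisjointTrees.of_le_genEdgeConn {V : Type*} [Fintype V] [DecidableEq V]
    {G : SimpleGraph V} {m : ℕ} (hV : 3 ≤ Fintype.card V) (h : m ≤ genEdgeConn G 3) {a b c : V}
    (hab : a ≠ b) (hac : a ≠ c) (hbc : b ≠ c) : HasEdgeDisjointTrees G {a, b, c} m :=
  (le_genEdgeConn_iff (by norm_num) hV).1 h _ (card_eq_three.2 ⟨a, b, c, hab, hac, hbc, rfl⟩)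

theorem exists_ne_ne {V : Type*} [Fintype V] (hV : 3 ≤ Fintype.card V) (u v : V) :
    ∃ w, w ≠ u ∧ w ≠ v := by
  classical
  obtain ⟨w, -, hw⟩ := exists_mem_notMem_of_card_lt_card (s := {u, v}) (t := univ)
    (card_le_two.trans_lt (by rw [card_univ]; lia))
  simp only [mem_insert, mem_singleton, not_or] at hw
  exact ⟨w, hw⟩

theorem ncard_edgeSet_eq {V : Type*} [Fintype V] (G : SimpleGraph V) [Fintype G.edgeSet] :
    G.edgeSet.ncard = #G.edgeFinset := by
  rw [edgeFinset, Set.ncard_eq_toFinset_card']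

/-- The set `X` of vertices of degree `l` is independent by `adj_bound`, so its edges all end in
`Xᶜ`, where degrees are at least `l + 1`. -/
theorem le_edges_of_le_genEdgeConn {V : Type*} [Fintype V] (G : SimpleGraph V) {l : ℕ}
    (hV : 3 ≤ Fintype.card V) (h : l ≤ genEdgeConn G 3) :
    l * (l + 1) * Fintype.card V ≤ (2 * l + 1) * G.edgeSet.ncard := by
  classical
  have hdeg : ∀ v, l ≤ G.degree v := by
    intro v
    obtain ⟨u, hu, -⟩ := exists_ne_ne hV v v
    obtain ⟨w, hw, hw'⟩ := exists_ne_ne hV v u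
    exact (HasEdgeDisjointTrees.of_le_genEdgeConn hV h hu.symm hw.symm hw'.symm).le_degree
      (u := v) (v := u) (by simp) (by simp) hu.symm
  set X : Finset V := {v | G.degree v = l} with hX
  have hind : ∀ u ∈ X, ∀ v ∈ X, ¬ G.Adj u v := by
    intro u hu v hv huv
    obtain ⟨w, hw, hw'⟩ := exists_ne_ne hV u v
    have := (HasEdgeDisjointTrees.of_le_genEdgeConn hV h huv.ne hw.symm hw'.symm).adj_bound
      (u := u) (v := v) (w := w) (by simp) (by simp) (by simp) huv hw.symm hw'.symm
    simp only [hX, mem_filter, mem_univ, true_and] at hu hv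
    lia
  have hXsum : ∑ v ∈ X, G.degree v = l * #X := by
    rw [sum_congr rfl fun v hv => (mem_filter.1 hv).2, sum_const, smul_eq_mul, mul_comm]
  have hYsum : (l + 1) * #Xᶜ ≤ ∑ v ∈ Xᶜ, G.degree v := by
    rw [mul_comm, ← smul_eq_mul]
    refine card_nsmul_le_sum _ _ _ fun v hv => ?_
    have h1 : G.degree v ≠ l := by simpa [hX] using hv
    have := hdeg v
    lia
  have hXY : ∑ v ∈ X, G.degree v ≤ ∑ v ∈ Xᶜ, G.degree v := by
    have h1 : ∀ v ∈ X, G.degree v = ∑ w ∈ Xᶜ, if G.Adj v w then 1 else 0 := by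
      intro v hv
      rw [degree_eq_add G X v, card_filter, add_eq_left, card_eq_zero, filter_eq_empty_iff]
      exact fun w hw => hind v hv w hw
    rw [sum_congr rfl h1, sum_comm]
    refine sum_le_sum fun w _ => ?_
    have h2 : (∑ v ∈ X, if G.Adj v w then 1 else 0) = #{v ∈ X | G.Adj w v} := by
      rw [card_filter]
      exact sum_congr rfl fun v _ => by rw [G.adj_comm]
    rw [degree_eq_add G X w, h2]
    lia
  have hcard : #X + #Xᶜ = Fintype.card V := card_add_card_compl X
  have hsum : ∑ v ∈ X, G.degree v + ∑ v ∈ Xᶜ, G.degree v = 2 * #G.edgeFinset := by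
    rw [sum_add_sum_compl, sum_degrees_eq_twice_card_edges]
  rw [ncard_edgeSet_eq, ← hcard]
  generalize ∑ v ∈ Xᶜ, G.degree v = y at *
  rw [hXsum] at hXY hsum
  -- Write `(2l+1)y = 2l·y + y` and apply `(l+1)|Xᶜ| ≤ y` to the first term and `l|X| ≤ y` to the
  -- second.
  nlinarith [Nat.mul_le_mul_left l hYsum]

theorem ncard_edgeSet_add_compl {V : Type*} [Fintype V] (G : SimpleGraph V) :
    G.edgeSet.ncard + Gᶜ.edgeSet.ncard = (Fintype.card V).choose 2 := by
  classical
  rw [← card_edgeFinset_top_eq_card_choose_two, ← ncard_edgeSet_eq, ← sup_compl_eq_top (x := G),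
    edgeSet_sup, Set.ncard_union_eq]
  rw [disjoint_edgeSet]
  exact disjoint_compl_right

theorem HasEdgeDisjointTrees.compl_bound {V : Type*} [Fintype V] [DecidableEq V]
    {G : SimpleGraph V} [DecidableRel G.Adj] {a b c : V} (hab : a ≠ b) (hac : a ≠ c) (hbc : b ≠ c)
    {m : ℕ} (h : HasEdgeDisjointTrees G {a, b, c} m) :
    6 * m + 9 + 2 * (Gᶜ.degree a + Gᶜ.degree b + Gᶜ.degree c) ≤
      6 * Fintype.card V + ((if Gᶜ.Adj a b then 1 else 0) + (if Gᶜ.Adj a c then 1 else 0) +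
      (if Gᶜ.Adj b c then 1 else 0)) := by
  have := h.triple_bound hab hac hbc
  have hd := fun v => G.degree_compl v
  have hl := fun v => G.degree_lt_card_verts v
  have ha := hd a; have hb := hd b; have hc := hd c
  have ha' := hl a; have hb' := hl b; have hc' := hl c
  simp only [compl_adj, hab, hac, hbc, ne_eq, not_false_eq_true, true_and]
  split_ifs at * <;> lia

theorem two_mul_adj_le_degree {V : Type*} [Fintype V] [DecidableEq V] (H : SimpleGraph V)
    [DecidableRel H.Adj] {a b c : V} (hab : a ≠ b) (hac : a ≠ c) (hbc : b ≠ c) :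
    2 * ((if H.Adj a b then 1 else 0) + (if H.Adj a c then 1 else 0) +
      (if H.Adj b c then 1 else 0)) ≤ H.degree a + H.degree b + H.degree c := by
  rw [degree_eq_add H {a, b, c} a, degree_eq_add H {a, b, c} b, degree_eq_add H {a, b, c} c,
    card_filter_triple H hab hac hbc, card_filter_triple H hab hac hbc,
    card_filter_triple H hab hac hbc]
  simp only [SimpleGraph.irrefl, if_false, H.adj_comm b a, H.adj_comm c a, H.adj_comm c b]
  lia

theorem genEdgeConn_three_le {V : Type*} [Fintype V] (G : SimpleGraph V)
    (hV : 3 ≤ Fintype.card V) : genEdgeConn G 3 ≤ Fintype.card V - 2 := by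
  classical
  obtain ⟨a, b, c, hab, hac, hbc⟩ := Fintype.two_lt_card_iff.1 hV
  have h1 := (HasEdgeDisjointTrees.of_le_genEdgeConn hV le_rfl hab hac hbc (G := G)).compl_bound
    hab hac hbc
  have h2 := two_mul_adj_le_degree Gᶜ hab hac hbc
  lia

/-- Any three vertices have complement degree sum at most 2, while an edge of the complement and an
end of another edge off it would give 3. -/
theorem ncard_compl_le_one {V : Type*} [Fintype V] (G : SimpleGraph V) (hV : 3 ≤ Fintype.card V)
    (h : Fintype.card V - 2 ≤ genEdgeConn G 3) : Gᶜ.edgeSet.ncard ≤ 1 := by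
  classical
  have hsum : ∀ a b c, a ≠ b → a ≠ c → b ≠ c →
      Gᶜ.degree a + Gᶜ.degree b + Gᶜ.degree c ≤ 2 := by
    intro a b c hab hac hbc
    have h1 := (HasEdgeDisjointTrees.of_le_genEdgeConn hV h hab hac hbc).compl_bound hab hac hbc
    have h2 := two_mul_adj_le_degree Gᶜ hab hac hbc
    lia
  have hpos : ∀ x y, Gᶜ.Adj x y → 1 ≤ Gᶜ.degree x := fun x y hxy =>
    (Gᶜ.degree_pos_iff_exists_adj x).2 ⟨y, hxy⟩
  have key : ∀ u v x y, Gᶜ.Adj u v → Gᶜ.Adj x y → x = u ∨ x = v := by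
    intro u v x y huv hxy
    by_contra! hx
    have := hsum u v x huv.ne hx.1.symm hx.2.symm
    have := hpos _ _ huv
    have := hpos _ _ huv.symm
    have := hpos _ _ hxy
    lia
  rw [Set.ncard_le_one]
  intro e he f hf
  induction e using Sym2.ind with
  | _ u v =>
  induction f using Sym2.ind with
  | _ x y =>
    have hne := ((mem_edgeSet _).1 hf).ne
    obtain rfl | rfl := key u v x y he hf <;> obtain rfl | rfl := key _ _ y _ he hf.symm <;>
      simp_all [Sym2.eq_swap]

/-- A triple has complement degree sum at most 6. If at most three vertices have complement degree 2
or more, the total is at most `6 + (n - 3)`. Otherwise any three of them form a complement triangle,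
so a fourth forces degree 3 and a sum above 6. -/
theorem two_mul_ncard_compl_le {V : Type*} [Fintype V] (G : SimpleGraph V)
    (hV : 3 ≤ Fintype.card V) (h : Fintype.card V - 3 ≤ genEdgeConn G 3) :
    2 * Gᶜ.edgeSet.ncard ≤ Fintype.card V + 3 := by
  classical
  have hsum : ∀ a b c, a ≠ b → a ≠ c → b ≠ c →
      2 * (Gᶜ.degree a + Gᶜ.degree b + Gᶜ.degree c) ≤ 9 + ((if Gᶜ.Adj a b then 1 else 0) +
        (if Gᶜ.Adj a c then 1 else 0) + (if Gᶜ.Adj b c then 1 else 0)) := by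
    intro a b c hab hac hbc
    have h1 := (HasEdgeDisjointTrees.of_le_genEdgeConn hV h hab hac hbc).compl_bound hab hac hbc
    lia
  rw [ncard_edgeSet_eq, ← sum_degrees_eq_twice_card_edges]
  set T : Finset V := {v | 2 ≤ Gᶜ.degree v} with hT
  have hmem : ∀ v ∈ T, 2 ≤ Gᶜ.degree v := fun v hv => (mem_filter.1 hv).2
  rcases le_or_gt #T 3 with hT3 | hT3
  · obtain ⟨S, hTS, hS⟩ := exists_superset_card_eq hT3 hV
    rw [← sum_add_sum_compl S]
    have h1 : ∑ v ∈ Sᶜ, Gᶜ.degree v ≤ #Sᶜ * 1 := by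
      refine sum_le_card_nsmul _ _ _ fun v hv => ?_
      by_contra hlt
      exact mem_compl.1 hv (hTS (mem_filter.2 ⟨mem_univ _, by lia⟩))
    have h2 : ∑ v ∈ S, Gᶜ.degree v ≤ 6 := by
      obtain ⟨a, b, c, hab, hac, hbc, rfl⟩ := card_eq_three.1 hS
      rw [sum_insert (by simp [hab, hac]), sum_insert (by simpa using hbc), sum_singleton]
      have := hsum a b c hab hac hbc
      split_ifs at this <;> lia
    rw [card_compl, hS] at h1
    lia
  · exfalso
    obtain ⟨a, ha, b, hb, c, hc, hab, hac, hbc⟩ := two_lt_card.1 (by lia : 2 < #T)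
    obtain ⟨d, hd, hd'⟩ := exists_mem_notMem_of_card_lt_card (card_le_three.trans_lt hT3)
      (s := {a, b, c})
    simp only [mem_insert, mem_singleton, not_or] at hd'
    have had := Ne.symm hd'.1
    have h1 := hsum a b c hab hac hbc
    have h2 := hsum a b d hab had (Ne.symm hd'.2.1)
    have := hmem a ha
    have := hmem b hb
    have := hmem c hc
    have := hmem d hd
    have hab' : Gᶜ.Adj a b := by by_contra h; rw [if_neg h] at h1; split_ifs at h1 <;> lia
    have hac' : Gᶜ.Adj a c := by by_contra h; rw [if_neg h] at h1; split_ifs at h1 <;> lia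
    have had' : Gᶜ.Adj a d := by by_contra h; rw [if_neg h] at h2; split_ifs at h2 <;> lia
    have h3 : 3 ≤ Gᶜ.degree a := by
      rw [← card_neighborFinset_eq_degree]
      refine (card_eq_three.2 ⟨b, c, d, hbc, Ne.symm hd'.2.1, Ne.symm hd'.2.2, rfl⟩).ge.trans
        (card_le_card fun x hx => ?_)
      simp only [mem_insert, mem_singleton] at hx
      rw [mem_neighborFinset]
      obtain rfl | rfl | rfl := hx <;> assumption
    split_ifs at h1 <;> lia

/-! ### Tree packings in complete multipartite graphs -/

/-- The complete multipartite graph whose parts are the fibres of `f`. -/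
abbrev partGraph {V : Type*} (f : V → ℕ) : SimpleGraph V := (⊤ : SimpleGraph ℕ).comap f

open Classical in
/-- An end of `e` outside `S`, if there is one. -/
noncomputable def outerEnd {V : Type*} (S : Finset V) (d : V) (e : Sym2 V) : V :=
  if h : ∃ x ∈ e, x ∉ S then h.choose else d

theorem outerEnd_mk {V : Type*} {S : Finset V} {x y : V} (d : V) (hx : x ∉ S) (hy : y ∈ S) :
    outerEnd S d s(x, y) = x := by
  have h : ∃ z ∈ s(x, y), z ∉ S := ⟨x, by simp, hx⟩
  rw [outerEnd, dif_pos h]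
  obtain ⟨h1, h2⟩ := h.choose_spec
  rcases Sym2.mem_iff.1 h1 with h3 | h3
  · exact h3
  · rw [h3] at h2
    exact absurd hy h2

theorem reachable_of_star {V : Type*} {H : SimpleGraph V} {x a b c : V} (ha : H.Adj x a)
    (hb : H.Adj x b) (hc : H.Adj x c) : H.Reachable a b ∧ H.Reachable a c :=
  ⟨ha.symm.reachable.trans hb.reachable, ha.symm.reachable.trans hc.reachable⟩

theorem card_compl_triple {V : Type*} [Fintype V] [DecidableEq V] {a b c : V} (hab : a ≠ b)
    (hac : a ≠ c) (hbc : b ≠ c) : #({a, b, c} : Finset V)ᶜ = Fintype.card V - 3 := by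
  rw [card_compl, card_eq_three.2 ⟨a, b, c, hab, hac, hbc, rfl⟩]

section Constructions

variable {V : Type*} [Fintype V] [DecidableEq V] {f : V → ℕ} {a b c : V}

/-- It suffices to colour the edges so that every vertex outside `{a, b, c}` is the colour of a
subgraph connecting `{a, b, c}`. -/
theorem hasEdgeDisjointTrees_of_outer_coloring (hab : a ≠ b) (hac : a ≠ c) (hbc : b ≠ c)
    (col : Sym2 V → V)
    (h : ∀ x, x ≠ a → x ≠ b → x ≠ c → outerEnd {a, b, c} a s(x, a) = x →
      outerEnd {a, b, c} a s(x, b) = x → outerEnd {a, b, c} a s(x, c) = x →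
      (colorClass (partGraph f) col x).Reachable a b ∧
      (colorClass (partGraph f) col x).Reachable a c) :
    HasEdgeDisjointTrees (partGraph f) {a, b, c} (Fintype.card V - 3) := by
  rw [← card_compl_triple hab hac hbc]
  refine hasEdgeDisjointTrees_of_coloring _ col fun x hx => ?_
  have hx' : x ∉ ({a, b, c} : Finset V) := mem_compl.1 hx
  have ha := outerEnd_mk a hx' (y := a) (by simp)
  have hb := outerEnd_mk a hx' (y := b) (by simp)
  have hc := outerEnd_mk a hx' (y := c) (by simp)
  simp only [mem_insert, mem_singleton, not_or] at hx'
  exact h x hx'.1 hx'.2.1 hx'.2.2 ha hb hc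

theorem hasEdgeDisjointTrees_of_stars (hab : a ≠ b) (hac : a ≠ c) (hbc : b ≠ c)
    (h : ∀ x, x ≠ a → x ≠ b → x ≠ c → f x ≠ f a ∧ f x ≠ f b ∧ f x ≠ f c) :
    HasEdgeDisjointTrees (partGraph f) {a, b, c} (Fintype.card V - 3) := by
  refine hasEdgeDisjointTrees_of_outer_coloring hab hac hbc (outerEnd {a, b, c} a)
    fun x xa xb xc ea eb ec => ?_
  obtain ⟨h1, h2, h3⟩ := h x xa xb xc
  exact reachable_of_star (x := x) ⟨h1, ea⟩ ⟨h2, eb⟩ ⟨h3, ec⟩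

/-- Each inner edge mends one incomplete star: `ab` goes to `p`, `bc` to `q`, `ac` to `r`. The
condition on each says that it is adjacent to the vertex off its inner edge. -/
theorem hasEdgeDisjointTrees_of_three_repairs (hab : f a ≠ f b) (hac : f a ≠ f c)
    (hbc : f b ≠ f c) (p q r : V)
    (h : ∀ x, x ≠ a → x ≠ b → x ≠ c → (f x ≠ f a ∧ f x ≠ f b ∧ f x ≠ f c) ∨
      (x = p ∧ f x ≠ f c) ∨ (x = q ∧ f x ≠ f a) ∨ (x = r ∧ f x ≠ f b)) :
    HasEdgeDisjointTrees (partGraph f) {a, b, c} (Fintype.card V - 3) := by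
  have nab : a ≠ b := fun h => hab (h ▸ rfl)
  have nac : a ≠ c := fun h => hac (h ▸ rfl)
  have nbc : b ≠ c := fun h => hbc (h ▸ rfl)
  set col : Sym2 V → V := fun e => if e = s(a, b) then p else if e = s(b, c) then q else
    if e = s(a, c) then r else outerEnd {a, b, c} a e with hcol
  have c1 : col s(a, b) = p := by simp [hcol]
  have c2 : col s(b, c) = q := by simp [hcol, nab.symm, nac.symm, nbc.symm]
  have c3 : col s(a, c) = r := by simp [hcol, nab, nac, nbc.symm]
  refine hasEdgeDisjointTrees_of_outer_coloring nab nac nbc col fun x xa xb xc ea eb ec => ?_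
  have ha : f x ≠ f a → (colorClass (partGraph f) col x).Adj x a := fun hx =>
    ⟨hx, by simp [hcol, xa, xb, xc, ea]⟩
  have hb : f x ≠ f b → (colorClass (partGraph f) col x).Adj x b := fun hx =>
    ⟨hx, by simp [hcol, xa, xb, xc, eb]⟩
  have hc : f x ≠ f c → (colorClass (partGraph f) col x).Adj x c := fun hx =>
    ⟨hx, by simp [hcol, xa, xb, xc, ec]⟩
  rcases h x xa xb xc with ⟨h1, h2, h3⟩ | ⟨rfl, h1⟩ | ⟨rfl, h1⟩ | ⟨rfl, h1⟩
  · exact reachable_of_star (ha h1) (hb h2) (hc h3)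
  · have he : (colorClass (partGraph f) col x).Adj a b := ⟨hab, c1⟩
    refine ⟨he.reachable, ?_⟩
    by_cases hx : f x = f a
    · exact he.reachable.trans ((hb (by lia)).symm.reachable.trans (hc h1).reachable)
    · exact (ha hx).symm.reachable.trans (hc h1).reachable
  · have he : (colorClass (partGraph f) col x).Adj b c := ⟨hbc, c2⟩
    by_cases hx : f x = f b
    · have := (ha h1).symm.reachable.trans (hc (by lia)).reachable
      exact ⟨this.trans he.symm.reachable, this⟩
    · have := (ha h1).symm.reachable.trans (hb hx).reachable
      exact ⟨this, this.trans he.reachable⟩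
  · have he : (colorClass (partGraph f) col x).Adj a c := ⟨hac, c3⟩
    refine ⟨?_, he.reachable⟩
    by_cases hx : f x = f a
    · exact he.reachable.trans ((hc (by lia)).symm.reachable.trans (hb h1).reachable)
    · exact (ha hx).symm.reachable.trans (hb h1).reachable

/-- Here `a` and `b` may share a part, so only `ac` and `bc` are available; they mend the stars of
at most two vertices in the part of `c`. -/
theorem hasEdgeDisjointTrees_of_two_repairs (hab : a ≠ b) (hac : f a ≠ f c)
    (hbc : f b ≠ f c) (p q : V)
    (h : ∀ x, x ≠ a → x ≠ b → x ≠ c → f x ≠ f a ∧ f x ≠ f b ∧ (f x = f c → x = p ∨ x = q)) :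
    HasEdgeDisjointTrees (partGraph f) {a, b, c} (Fintype.card V - 3) := by
  have nac : a ≠ c := fun h => hac (h ▸ rfl)
  have nbc : b ≠ c := fun h => hbc (h ▸ rfl)
  set col : Sym2 V → V := fun e => if e = s(a, c) then p else if e = s(b, c) then q else
    outerEnd {a, b, c} a e with hcol
  have c1 : col s(a, c) = p := by simp [hcol]
  have c2 : col s(b, c) = q := by simp [hcol, hab.symm, nac.symm]
  refine hasEdgeDisjointTrees_of_outer_coloring hab nac nbc col fun x xa xb xc ea eb ec => ?_
  obtain ⟨h1, h2, h3⟩ := h x xa xb xc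
  have ha : (colorClass (partGraph f) col x).Adj x a :=
    ⟨h1, by simp [hcol, xa, xb, xc, ea]⟩
  have hb : (colorClass (partGraph f) col x).Adj x b :=
    ⟨h2, by simp [hcol, xa, xb, xc, eb]⟩
  have hr := ha.symm.reachable.trans hb.reachable
  refine ⟨hr, ?_⟩
  by_cases hx : f x = f c
  · obtain rfl | rfl := h3 hx
    · exact Adj.reachable ⟨hac, c1⟩
    · exact hr.trans (Adj.reachable ⟨hbc, c2⟩)
  · exact ha.symm.reachable.trans (Adj.reachable
      ⟨hx, by simp [hcol, xa, xb, xc, ec]⟩)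

/-- The path `a`–`c`–`b` replaces the star of the one exceptional vertex `t`. -/
theorem hasEdgeDisjointTrees_of_path (hab : a ≠ b) (hac : f a ≠ f c)
    (hbc : f b ≠ f c) (t : V)
    (h : ∀ x, x ≠ a → x ≠ b → x ≠ c → x ≠ t → f x ≠ f a ∧ f x ≠ f b ∧ f x ≠ f c) :
    HasEdgeDisjointTrees (partGraph f) {a, b, c} (Fintype.card V - 3) := by
  have nac : a ≠ c := fun h => hac (h ▸ rfl)
  have nbc : b ≠ c := fun h => hbc (h ▸ rfl)
  set col : Sym2 V → V := fun e => if e = s(a, c) ∨ e = s(b, c) then t else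
    outerEnd {a, b, c} a e with hcol
  refine hasEdgeDisjointTrees_of_outer_coloring hab nac nbc col fun x xa xb xc ea eb ec => ?_
  rcases eq_or_ne x t with rfl | hx
  · have h1 : (colorClass (partGraph f) col x).Adj a c := ⟨hac, by simp [hcol]⟩
    have h2 : (colorClass (partGraph f) col x).Adj b c := ⟨hbc, by simp [hcol]⟩
    exact ⟨h1.reachable.trans h2.symm.reachable, h1.reachable⟩
  · obtain ⟨h1, h2, h3⟩ := h x xa xb xc hx
    exact reachable_of_star (x := x) ⟨h1, by simp [hcol, xa, xb, xc, ea]⟩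
      ⟨h2, by simp [hcol, xa, xb, xc, eb]⟩
      ⟨h3, by simp [hcol, xa, xb, xc, ec]⟩

/-- The path `a`–`c`–`b` serves as the tree of `r`. This frees `ra` and `rb`, and the tree of `t`
becomes `c`–`t`–`r` together with these two edges. -/
theorem hasEdgeDisjointTrees_of_triangle_pair (hab : f a = f b) (nab : a ≠ b) (hac : f a ≠ f c)
    {t r : V} (hta : t ≠ a) (htb : t ≠ b) (hrc : r ≠ c) (hft : f t = f a) (hfr : f r = f c)
    (h : ∀ x, x ≠ a → x ≠ b → x ≠ c → x ≠ t → x ≠ r → f x ≠ f a ∧ f x ≠ f b ∧ f x ≠ f c) :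
    HasEdgeDisjointTrees (partGraph f) {a, b, c} (Fintype.card V - 3) := by
  have nac : a ≠ c := fun h => hac (h ▸ rfl)
  have nbc : b ≠ c := fun h => hac (by rw [hab, h])
  have ntc : t ≠ c := fun h => hac (by rw [← hft, h])
  have ntr : t ≠ r := fun h => hac (by rw [← hft, h, hfr])
  have nra : r ≠ a := fun h => hac (by rw [← hfr, h])
  have nrb : r ≠ b := fun h => hac (by rw [← hfr, h, hab])
  set col : Sym2 V → V := fun e => if e = s(a, c) ∨ e = s(b, c) then r else
    if e = s(t, r) ∨ e = s(r, a) ∨ e = s(r, b) then t else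
    outerEnd {a, b, c} a e with hcol
  refine hasEdgeDisjointTrees_of_outer_coloring nab nac nbc col fun x xa xb xc ea eb ec => ?_
  rcases eq_or_ne x r with rfl | hxr
  · have h1 : (colorClass (partGraph f) col x).Adj a c := ⟨hac, by simp [hcol]⟩
    have h2 : (colorClass (partGraph f) col x).Adj b c := ⟨show f b ≠ f c by lia, by simp [hcol]⟩
    exact ⟨h1.reachable.trans h2.symm.reachable, h1.reachable⟩
  rcases eq_or_ne x t with rfl | hxt
  · have h1 : (colorClass (partGraph f) col x).Adj x c := ⟨show f x ≠ f c by lia,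
      by simp [hcol, xa, xb, xc, ec, hrc.symm, hxr]⟩
    have h2 : (colorClass (partGraph f) col x).Adj x r := ⟨show f x ≠ f r by lia,
      by simp [hcol, xa, xb, xc]⟩
    have h3 : (colorClass (partGraph f) col x).Adj r a := ⟨show f r ≠ f a by lia,
      by simp [hcol, nra, nrb, hrc]⟩
    have h4 : (colorClass (partGraph f) col x).Adj r b := ⟨show f r ≠ f b by lia,
      by simp [hcol, nra, nrb, hrc]⟩
    exact ⟨h3.symm.reachable.trans h4.reachable,
      h3.symm.reachable.trans (h2.symm.reachable.trans h1.reachable)⟩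
  · obtain ⟨h1, h2, h3⟩ := h x xa xb xc hxt hxr
    exact reachable_of_star (x := x)
      ⟨h1, by simp [hcol, xa, xb, xc, ea, hxt, hxr]⟩
      ⟨h2, by simp [hcol, xa, xb, xc, eb, hxt, hxr]⟩
      ⟨h3, by simp [hcol, xa, xb, xc, ec, hxt, hxr]⟩

/-- Four incomplete stars face three inner edges. The path `a`–`b`–`c` serves `r`, and `ac` mends
the star of `t`. The tree of `u` reaches `a` through `q`, and that of `q` reaches `a` and `b`
through `r`, whose own edges are free. -/
theorem hasEdgeDisjointTrees_of_four_repairs (hab : f a ≠ f b) (hac : f a ≠ f c)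
    (hbc : f b ≠ f c) {t u q r : V} (hta : t ≠ a) (hua : u ≠ a) (htu : t ≠ u) (hqb : q ≠ b)
    (hrc : r ≠ c) (hft : f t = f a) (hfu : f u = f a) (hfq : f q = f b) (hfr : f r = f c)
    (h : ∀ x, x ≠ a → x ≠ b → x ≠ c → x ≠ t → x ≠ u → x ≠ q → x ≠ r →
      f x ≠ f a ∧ f x ≠ f b ∧ f x ≠ f c) :
    HasEdgeDisjointTrees (partGraph f) {a, b, c} (Fintype.card V - 3) := by
  have ne : ∀ x y : V, f x ≠ f y → x ≠ y := fun x y h h' => h (h' ▸ rfl)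
  have nab := ne a b hab
  have nac := ne a c hac
  have nbc := ne b c hbc
  have nqa := ne q a (by lia)
  have nqc := ne q c (by lia)
  have nqu := ne q u (by lia)
  have nqt := ne q t (by lia)
  have nqr := ne q r (by lia)
  have nra := ne r a (by lia)
  have nrb := ne r b (by lia)
  have nru := ne r u (by lia)
  have nrt := ne r t (by lia)
  have nub := ne u b (by lia)
  have nuc := ne u c (by lia)
  have ntb := ne t b (by lia)
  have ntc := ne t c (by lia)
  set col : Sym2 V → V := fun e => if e = s(a, b) ∨ e = s(b, c) then r else
    if e = s(a, c) then t else
    if e = s(u, q) ∨ e = s(q, a) then u else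
    if e = s(q, r) ∨ e = s(r, a) ∨ e = s(r, b) then q else
    outerEnd {a, b, c} a e with hcol
  refine hasEdgeDisjointTrees_of_outer_coloring nab nac nbc col fun x xa xb xc ea eb ec => ?_
  rcases eq_or_ne x r with rfl | hxr
  · have h1 : (colorClass (partGraph f) col x).Adj a b := ⟨hab, by simp [hcol]⟩
    have h2 : (colorClass (partGraph f) col x).Adj b c := ⟨hbc, by simp [hcol]⟩
    exact ⟨h1.reachable, h1.reachable.trans h2.reachable⟩
  rcases eq_or_ne x t with rfl | hxt
  · have h1 : (colorClass (partGraph f) col x).Adj x b := ⟨show f x ≠ f b by lia,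
      by simp [hcol, xa, xb, xc, eb, htu, nqt.symm, hxr]⟩
    have h2 : (colorClass (partGraph f) col x).Adj x c := ⟨show f x ≠ f c by lia,
      by simp [hcol, xa, xb, xc, ec, htu, nqt.symm, hxr]⟩
    have h3 : (colorClass (partGraph f) col x).Adj a c := ⟨hac,
      by simp [hcol, nab, nac, nbc.symm]⟩
    exact ⟨h3.reachable.trans (h2.symm.reachable.trans h1.reachable), h3.reachable⟩
  rcases eq_or_ne x u with rfl | hxu
  · have h1 : (colorClass (partGraph f) col x).Adj x b := ⟨show f x ≠ f b by lia,
      by simp [hcol, xa, xb, xc, eb, nqu.symm, hxr, hqb.symm]⟩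
    have h2 : (colorClass (partGraph f) col x).Adj x c := ⟨show f x ≠ f c by lia,
      by simp [hcol, xa, xb, xc, ec, nqu.symm, hxr, nqc.symm]⟩
    have h3 : (colorClass (partGraph f) col x).Adj x q := ⟨show f x ≠ f q by lia,
      by simp [hcol, xa, xb, xc]⟩
    have h4 : (colorClass (partGraph f) col x).Adj q a := ⟨show f q ≠ f a by lia,
      by simp [hcol, nqa, hqb, nqc]⟩
    have h5 := h4.symm.reachable.trans h3.symm.reachable
    exact ⟨h5.trans h1.reachable, h5.trans h2.reachable⟩
  rcases eq_or_ne x q with rfl | hxq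
  · have h1 : (colorClass (partGraph f) col x).Adj x c := ⟨show f x ≠ f c by lia,
      by simp [hcol, xa, xb, xc, ec, nuc.symm, nac.symm, hxr, hrc.symm, hxu]⟩
    have h2 : (colorClass (partGraph f) col x).Adj x r := ⟨show f x ≠ f r by lia,
      by simp [hcol, xa, xb, xc, nru, nra, hxu]⟩
    have h3 : (colorClass (partGraph f) col x).Adj r a := ⟨show f r ≠ f a by lia,
      by simp [hcol, nra, nrb, hrc, nru, nqr.symm]⟩
    have h4 : (colorClass (partGraph f) col x).Adj r b := ⟨show f r ≠ f b by lia,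
      by simp [hcol, nra, nrb, hrc, nru, nqr.symm]⟩
    exact ⟨h3.symm.reachable.trans h4.reachable,
      h3.symm.reachable.trans (h2.symm.reachable.trans h1.reachable)⟩
  · obtain ⟨h1, h2, h3⟩ := h x xa xb xc hxt hxu hxq hxr
    exact reachable_of_star (x := x)
      ⟨h1, by simp [hcol, xa, xb, xc, ea, hxu, hxq, hxr]⟩
      ⟨h2, by simp [hcol, xa, xb, xc, eb, hxu, hxq, hxr]⟩
      ⟨h3, by simp [hcol, xa, xb, xc, ec, hxu, hxq, hxr]⟩

/-- With a path inside `{a, b, c}` as an additional tree. -/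
theorem hasEdgeDisjointTrees_succ_of_pair (hab : a ≠ b) (hac : f a ≠ f c) (hbc : f b ≠ f c)
    (h : ∀ x, x ≠ a → x ≠ b → x ≠ c → f x ≠ f a ∧ f x ≠ f b ∧ f x ≠ f c) :
    HasEdgeDisjointTrees (partGraph f) {a, b, c} (Fintype.card V - 3 + 1) := by
  have nac : a ≠ c := fun h => hac (h ▸ rfl)
  have nbc : b ≠ c := fun h => hbc (h ▸ rfl)
  rw [← card_compl_triple hab nac nbc, ← card_insert_of_notMem (a := a) (by simp)]
  set col : Sym2 V → V := outerEnd {a, b, c} a with hcol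
  have hin : ∀ y z, y ∈ ({a, b, c} : Finset V) → z ∈ ({a, b, c} : Finset V) →
      col s(y, z) = a := by
    intro y z hy hz
    rw [hcol, outerEnd, dif_neg]
    rintro ⟨w, hw, hw'⟩
    obtain rfl | rfl := Sym2.mem_iff.1 hw <;> contradiction
  refine hasEdgeDisjointTrees_of_coloring _ col fun x hx => ?_
  rcases mem_insert.1 hx with rfl | hx
  · have h1 : (colorClass (partGraph f) col x).Adj x c := ⟨hac, hin _ _ (by simp) (by simp)⟩
    have h2 : (colorClass (partGraph f) col x).Adj b c := ⟨hbc, hin _ _ (by simp) (by simp)⟩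
    exact ⟨h1.reachable.trans h2.symm.reachable, h1.reachable⟩
  · have hx' := mem_compl.1 hx
    have hx'' := hx'
    simp only [mem_insert, mem_singleton, not_or] at hx''
    obtain ⟨h1, h2, h3⟩ := h x hx''.1 hx''.2.1 hx''.2.2
    exact reachable_of_star (x := x) ⟨h1, outerEnd_mk a hx' (by simp)⟩
      ⟨h2, outerEnd_mk a hx' (by simp)⟩ ⟨h3, outerEnd_mk a hx' (by simp)⟩

/-- Only one star can be incomplete: `ac` mends it, and the path `a`–`b`–`c` is the additional tree,
with colour `a`. -/
theorem hasEdgeDisjointTrees_succ_of_one_repair (hab : f a ≠ f b) (hac : f a ≠ f c)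
    (hbc : f b ≠ f c) (p : V) (hp : p ≠ a)
    (h : ∀ x, x ≠ a → x ≠ b → x ≠ c → (f x = f a → x = p) ∧ f x ≠ f b ∧ f x ≠ f c) :
    HasEdgeDisjointTrees (partGraph f) {a, b, c} (Fintype.card V - 3 + 1) := by
  have nab : a ≠ b := fun h => hab (h ▸ rfl)
  have nac : a ≠ c := fun h => hac (h ▸ rfl)
  have nbc : b ≠ c := fun h => hbc (h ▸ rfl)
  rw [← card_compl_triple nab nac nbc, ← card_insert_of_notMem (a := a) (by simp)]
  set col : Sym2 V → V := fun e => if e = s(a, c) then p else outerEnd {a, b, c} a e with hcol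
  have hin : ∀ y z, y ∈ ({a, b, c} : Finset V) → z ∈ ({a, b, c} : Finset V) →
      outerEnd {a, b, c} a s(y, z) = a := by
    intro y z hy hz
    rw [outerEnd, dif_neg]
    rintro ⟨w, hw, hw'⟩
    obtain rfl | rfl := Sym2.mem_iff.1 hw <;> contradiction
  have c1 : col s(a, b) = a := by
    simp [hcol, nab, nac, nbc, hin]
  have c2 : col s(b, c) = a := by
    simp [hcol, nab.symm, nbc, hin]
  have c3 : col s(a, c) = p := by simp [hcol]
  refine hasEdgeDisjointTrees_of_coloring _ col fun x hx => ?_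
  rcases mem_insert.1 hx with rfl | hx
  · have h1 : (colorClass (partGraph f) col x).Adj x b := ⟨hab, c1⟩
    have h2 : (colorClass (partGraph f) col x).Adj b c := ⟨hbc, c2⟩
    exact ⟨h1.reachable, h1.reachable.trans h2.reachable⟩
  · have hx' := mem_compl.1 hx
    have hx'' := hx'
    simp only [mem_insert, mem_singleton, not_or] at hx''
    obtain ⟨xa, xb, xc⟩ := hx''
    obtain ⟨h1, h2, h3⟩ := h x xa xb xc
    have hb : (colorClass (partGraph f) col x).Adj x b :=
      ⟨h2, by simp [hcol, xa, xc, outerEnd_mk a hx']⟩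
    have hc : (colorClass (partGraph f) col x).Adj x c :=
      ⟨h3, by simp [hcol, xa, xc, outerEnd_mk a hx']⟩
    by_cases hxa : f x = f a
    · obtain rfl := h1 hxa
      have he : (colorClass (partGraph f) col x).Adj a c := ⟨hac, c3⟩
      exact ⟨he.reachable.trans (hc.symm.reachable.trans hb.reachable), he.reachable⟩
    · exact reachable_of_star (x := x)
        ⟨hxa, by simp [hcol, xa, xc, outerEnd_mk a hx']⟩ hb hc

end Constructions

/-! ### The two dense extremal graphs -/

theorem insert_comm_left {V : Type*} [DecidableEq V] (a b c : V) :
    ({a, b, c} : Finset V) = {b, a, c} := Finset.insert_comm a b _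

theorem insert_comm_right {V : Type*} [DecidableEq V] (a b c : V) :
    ({a, b, c} : Finset V) = {a, c, b} := by rw [Finset.pair_comm]

/-- `K_n` minus an edge. -/
abbrev nearComplete (n : ℕ) : SimpleGraph (Fin n) := partGraph fun v => v.val - 1

theorem le_genEdgeConn_nearComplete {n : ℕ} (hn : 3 ≤ n) :
    n - 2 ≤ genEdgeConn (nearComplete n) 3 := by
  rw [le_genEdgeConn_iff (by norm_num) (by simpa using hn)]
  intro S hS
  obtain ⟨a, b, c, hab, hac, hbc, rfl⟩ := card_eq_three.1 hS
  obtain ⟨k, rfl⟩ : ∃ k, n = k + 3 := ⟨n - 3, by lia⟩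
  have key1 : ∀ a b c : Fin (k + 3), a ≠ b → a ≠ c → b ≠ c → a.val - 1 = b.val - 1 →
      HasEdgeDisjointTrees (nearComplete (k + 3)) {a, b, c} (k + 3 - 2) := by
    intro a b c hab hac hbc h
    have := hasEdgeDisjointTrees_succ_of_pair (f := fun v : Fin (k + 3) => v.val - 1)
      (a := a) (b := b) (c := c) hab (by lia) (by lia) (fun x _ _ _ => by lia)
    simpa using this
  -- With `b` and `c` outside part `0`, the only part with two vertices, only `a` can have a mate.
  have key2 : ∀ a b c : Fin (k + 3), a.val - 1 ≠ b.val - 1 → a.val - 1 ≠ c.val - 1 →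
      b.val - 1 ≠ c.val - 1 → 0 < b.val - 1 → 0 < c.val - 1 →
      HasEdgeDisjointTrees (nearComplete (k + 3)) {a, b, c} (k + 3 - 2) := by
    intro a b c hab hac hbc hb hc
    have hp : ∃ p, p ≠ a ∧ ∀ x : Fin (k + 3), x ≠ a → x.val - 1 = a.val - 1 → x = p := by
      by_cases h : ∃ p : Fin (k + 3), p ≠ a ∧ p.val - 1 = a.val - 1
      · obtain ⟨p, hp, hpa⟩ := h
        exact ⟨p, hp, fun x hx hxa => by lia⟩
      · push Not at h
        exact ⟨b, by lia, fun x hx hxa => absurd hxa (h x hx)⟩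
    obtain ⟨p, hpa, hp⟩ := hp
    have := hasEdgeDisjointTrees_succ_of_one_repair (f := fun v : Fin (k + 3) => v.val - 1)
      (a := a) (b := b) (c := c) hab hac hbc p hpa
      (fun x hxa hxb hxc => ⟨hp x hxa, by lia, by lia⟩)
    simpa using this
  by_cases h1 : a.val - 1 = b.val - 1
  · exact key1 a b c hab hac hbc h1
  by_cases h2 : a.val - 1 = c.val - 1
  · rw [insert_comm_right]
    exact key1 a c b hac hab hbc.symm h2
  by_cases h3 : b.val - 1 = c.val - 1
  · rw [insert_comm_left, insert_comm_right]
    exact key1 b c a hbc hab.symm hac.symm h3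
  rcases Nat.eq_zero_or_pos (b.val - 1) with hb | hb
  · rw [insert_comm_left]
    exact key2 b a c (Ne.symm h1) h3 h2 (by lia) (by lia)
  rcases Nat.eq_zero_or_pos (c.val - 1) with hc | hc
  · rw [insert_comm_right, insert_comm_left]
    exact key2 c a b (Ne.symm h2) (Ne.symm h3) h1 (by lia) (by lia)
  exact key2 a b c h1 h2 h3 hb hc

/-- `K_n` minus a triangle and a maximum matching on the other vertices. -/
abbrev sparseDeletion (n : ℕ) : SimpleGraph (Fin n) := partGraph fun v => (v.val - 1) / 2

/-- A third vertex `t` in the part of `a` and `b` makes it the triangle, so `c` has at most one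
mate. Without such a `t`, only the at most two mates of `c` need repair. -/
theorem hasEdgeDisjointTrees_sparseDeletion_of_eq {n : ℕ} {a b c : Fin n} (nab : a ≠ b)
    (hab : (a.val - 1) / 2 = (b.val - 1) / 2) (hac : (a.val - 1) / 2 ≠ (c.val - 1) / 2) :
    HasEdgeDisjointTrees (sparseDeletion n) {a, b, c} (n - 3) := by
  set f : Fin n → ℕ := fun v => (v.val - 1) / 2 with hf
  suffices HasEdgeDisjointTrees (partGraph f) {a, b, c} (Fintype.card (Fin n) - 3) by
    simpa using this
  by_cases ht : ∃ t : Fin n, t ≠ a ∧ t ≠ b ∧ (t.val - 1) / 2 = (a.val - 1) / 2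
  · obtain ⟨t, hta, htb, ht⟩ := ht
    by_cases hr : ∃ r : Fin n, r ≠ c ∧ (r.val - 1) / 2 = (c.val - 1) / 2
    · obtain ⟨r, hrc, hr⟩ := hr
      refine hasEdgeDisjointTrees_of_triangle_pair (f := f) (t := t) (r := r) hab nab hac hta htb
        hrc ht hr fun x _ _ _ _ _ => ?_
      simp only [hf]
      lia
    · push Not at hr
      refine hasEdgeDisjointTrees_of_path (f := f) nab hac (by simp only [hf]; lia) t
        fun x _ _ hxc _ => ?_
      have := hr x hxc
      simp only [hf]
      lia
  · push Not at ht
    have hpq : ∃ p q : Fin n, ∀ x, x ≠ c → (x.val - 1) / 2 = (c.val - 1) / 2 →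
        x = p ∨ x = q := by
      by_cases hp : ∃ p : Fin n, p ≠ c ∧ (p.val - 1) / 2 = (c.val - 1) / 2
      · obtain ⟨p, hpc, hp⟩ := hp
        by_cases hq : ∃ q : Fin n, q ≠ c ∧ q ≠ p ∧ (q.val - 1) / 2 = (c.val - 1) / 2
        · obtain ⟨q, hqc, hqp, hq⟩ := hq
          exact ⟨p, q, fun x _ _ => by lia⟩
        · push Not at hq
          exact ⟨p, p, fun x hx hx' => Or.inl (by by_contra h; exact hq x hx h hx')⟩
      · push Not at hp
        exact ⟨c, c, fun x hx hx' => absurd hx' (hp x hx)⟩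
    obtain ⟨p, q, hpq⟩ := hpq
    refine hasEdgeDisjointTrees_of_two_repairs (f := f) nab hac (by simp only [hf]; lia) p q
      fun x hxa hxb hxc => ⟨ht x hxa hxb, ?_, hpq x hxc⟩
    have := ht x hxa hxb
    simp only [hf]
    lia

/-- Since `b` and `c` avoid the triangle, each has at most one mate and `a` at most two. Three inner
edges suffice unless all four mates exist. -/
theorem hasEdgeDisjointTrees_sparseDeletion_of_ne {n : ℕ} {a b c : Fin n}
    (hab : (a.val - 1) / 2 ≠ (b.val - 1) / 2) (hac : (a.val - 1) / 2 ≠ (c.val - 1) / 2)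
    (hbc : (b.val - 1) / 2 ≠ (c.val - 1) / 2) (hb : 0 < (b.val - 1) / 2)
    (hc : 0 < (c.val - 1) / 2) :
    HasEdgeDisjointTrees (sparseDeletion n) {a, b, c} (n - 3) := by
  set f : Fin n → ℕ := fun v => (v.val - 1) / 2 with hf
  suffices HasEdgeDisjointTrees (partGraph f) {a, b, c} (Fintype.card (Fin n) - 3) by
    simpa using this
  have hpair : ∀ y : Fin n, 0 < (y.val - 1) / 2 →
      (∃ q : Fin n, q ≠ y ∧ (q.val - 1) / 2 = (y.val - 1) / 2 ∧
        ∀ x, x ≠ y → (x.val - 1) / 2 = (y.val - 1) / 2 → x = q) ∨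
      ∀ x, x ≠ y → (x.val - 1) / 2 ≠ (y.val - 1) / 2 := by
    intro y hy
    by_cases h : ∃ q : Fin n, q ≠ y ∧ (q.val - 1) / 2 = (y.val - 1) / 2
    · obtain ⟨q, hq, hqy⟩ := h
      exact Or.inl ⟨q, hq, hqy, fun x _ _ => by lia⟩
    · push Not at h
      exact Or.inr h
  have ha : ∃ p q : Fin n, (p ≠ a ∧ q ≠ a ∧ p ≠ q ∧ (p.val - 1) / 2 = (a.val - 1) / 2 ∧
      (q.val - 1) / 2 = (a.val - 1) / 2 ∨ p = q) ∧
      ∀ x, x ≠ a → (x.val - 1) / 2 = (a.val - 1) / 2 → x = p ∨ x = q := by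
    by_cases hp : ∃ p : Fin n, p ≠ a ∧ (p.val - 1) / 2 = (a.val - 1) / 2
    · obtain ⟨p, hpa, hp⟩ := hp
      by_cases hq : ∃ q : Fin n, q ≠ a ∧ q ≠ p ∧ (q.val - 1) / 2 = (a.val - 1) / 2
      · obtain ⟨q, hqa, hqp, hq⟩ := hq
        exact ⟨p, q, Or.inl ⟨hpa, hqa, hqp.symm, hp, hq⟩, fun x _ _ => by lia⟩
      · push Not at hq
        exact ⟨p, p, Or.inr rfl, fun x hx hx' => Or.inl (by by_contra h; exact hq x hx h hx')⟩
    · push Not at hp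
      exact ⟨a, a, Or.inr rfl, fun x hx hx' => absurd hx' (hp x hx)⟩
  obtain ⟨p, q, hpq, ha⟩ := ha
  rcases hpair b hb with ⟨s, hsb, hs, hb'⟩ | hb' <;> rcases hpair c hc with ⟨r, hrc, hr, hc'⟩ | hc'
  · rcases hpq with ⟨hpa, hqa, hne, hfp, hfq⟩ | rfl
    · refine hasEdgeDisjointTrees_of_four_repairs (f := f) (t := p) (u := q) (q := s) (r := r)
        hab hac hbc hpa hqa hne hsb hrc hfp hfq hs hr fun x hxa hxb hxc h1 h2 h3 h4 => ?_
      exact ⟨fun h => (ha x hxa h).elim h1 h2, fun h => h3 (hb' x hxb h),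
        fun h => h4 (hc' x hxc h)⟩
    · refine hasEdgeDisjointTrees_of_three_repairs (f := f) hab hac hbc p s r
        fun x hxa hxb hxc => ?_
      have := ha x hxa
      have := hb' x hxb
      have := hc' x hxc
      simp only [hf]
      lia
  · refine hasEdgeDisjointTrees_of_three_repairs (f := f) hab hac hbc p s q
      fun x hxa hxb hxc => ?_
    have := ha x hxa
    have := hb' x hxb
    have := hc' x hxc
    simp only [hf]
    lia
  · refine hasEdgeDisjointTrees_of_three_repairs (f := f) hab hac hbc p r q
      fun x hxa hxb hxc => ?_
    have := ha x hxa
    have := hb' x hxb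
    have := hc' x hxc
    simp only [hf]
    lia
  · refine hasEdgeDisjointTrees_of_three_repairs (f := f) hab hac hbc p p q
      fun x hxa hxb hxc => ?_
    have := ha x hxa
    have := hb' x hxb
    have := hc' x hxc
    simp only [hf]
    lia

theorem le_genEdgeConn_sparseDeletion {n : ℕ} (hn : 3 ≤ n) :
    n - 3 ≤ genEdgeConn (sparseDeletion n) 3 := by
  rw [le_genEdgeConn_iff (by norm_num) (by simpa using hn)]
  intro S hS
  obtain ⟨a, b, c, hab, hac, hbc, rfl⟩ := card_eq_three.1 hS
  by_cases h1 : (a.val - 1) / 2 = (b.val - 1) / 2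
  · by_cases h2 : (a.val - 1) / 2 = (c.val - 1) / 2
    · have := hasEdgeDisjointTrees_of_stars (f := fun v : Fin n => (v.val - 1) / 2) hab hac hbc
        fun x _ _ _ => by lia
      simpa using this
    · exact hasEdgeDisjointTrees_sparseDeletion_of_eq hab h1 h2
  by_cases h2 : (a.val - 1) / 2 = (c.val - 1) / 2
  · rw [insert_comm_right]
    exact hasEdgeDisjointTrees_sparseDeletion_of_eq hac h2 h1
  by_cases h3 : (b.val - 1) / 2 = (c.val - 1) / 2
  · rw [insert_comm_left, insert_comm_right]
    exact hasEdgeDisjointTrees_sparseDeletion_of_eq hbc h3 (Ne.symm h1)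
  rcases Nat.eq_zero_or_pos ((b.val - 1) / 2) with hb | hb
  · rw [insert_comm_left]
    exact hasEdgeDisjointTrees_sparseDeletion_of_ne (Ne.symm h1) h3 h2 (by lia) (by lia)
  rcases Nat.eq_zero_or_pos ((c.val - 1) / 2) with hc | hc
  · rw [insert_comm_right, insert_comm_left]
    exact hasEdgeDisjointTrees_sparseDeletion_of_ne (Ne.symm h2) (Ne.symm h3) h1 (by lia) (by lia)
  exact hasEdgeDisjointTrees_sparseDeletion_of_ne h1 h2 h3 hb hc

theorem le_ncard_compl_sparseDeletion {n : ℕ} (hn : 3 ≤ n) :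
    (n + 3) / 2 ≤ (sparseDeletion n)ᶜ.edgeSet.ncard := by
  have hadj : ∀ u v : Fin n, (sparseDeletion n)ᶜ.Adj u v ↔
      u ≠ v ∧ (u.val - 1) / 2 = (v.val - 1) / 2 := by
    intro u v
    simp [compl_adj]
  -- The first `(n - 1) / 2` indices give the pairs `{2i+1, 2i+2}`; the last two give the triangle
  -- edges `{0, 1}` and `{0, 2}`.
  let g : Fin ((n + 3) / 2) → Sym2 (Fin n) := fun i =>
    if h : 2 * i.val + 2 < n then s(⟨2 * i + 1, by lia⟩, ⟨2 * i + 2, h⟩)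
    else s(⟨0, by lia⟩, ⟨i.val - (n - 1) / 2 + 1, by lia⟩)
  have hinj : Function.Injective g := by
    intro i j hij
    simp only [g] at hij
    split_ifs at hij <;> simp only [Sym2.eq_iff, Fin.mk.injEq] at hij <;> ext <;> lia
  calc (n + 3) / 2 = (Set.range g).ncard := by
        rw [← Set.image_univ, Set.ncard_image_of_injective _ hinj, Set.ncard_univ]
        simp
    _ ≤ _ := Set.ncard_le_ncard ?_ (Set.toFinite _)
  rintro _ ⟨i, rfl⟩
  simp only [g]
  split_ifs <;> rw [mem_edgeSet, hadj] <;> simp only [ne_eq, Fin.mk.injEq] <;> lia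

/-! ### The complete bipartite graph `K_{ℓ,ℓ+1}` -/

section Bipartite

theorem hasEdgeDisjointTrees_of_biColoring {X Y : Type*} [Fintype X] {S : Finset (X ⊕ Y)}
    (hS : S.Nonempty) (col : X → Y → X)
    (h : ∀ i, ∀ H : SimpleGraph (X ⊕ Y), (∀ x y, col x y = i → H.Adj (.inl x) (.inr y)) →
      ∃ z, ∀ u ∈ S, H.Reachable z u) :
    HasEdgeDisjointTrees (completeBipartiteGraph X Y) S (Fintype.card X) := by
  rw [← card_univ]
  refine hasEdgeDisjointTrees_of_subgraphs hS univ
    (fun i => fromEdgeSet {e | ∃ x y, col x y = i ∧ e = s(.inl x, .inr y)}) ?_ ?_ ?_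
  · rintro i - u v huv
    obtain ⟨⟨x, y, -, hxy⟩, -⟩ := (fromEdgeSet_adj _).1 huv
    rw [← mem_edgeSet, hxy]
    simp
  · rintro i - j - u v hi hj
    obtain ⟨⟨x, y, rfl, hxy⟩, -⟩ := (fromEdgeSet_adj _).1 hi
    obtain ⟨⟨x', y', rfl, hxy'⟩, -⟩ := (fromEdgeSet_adj _).1 hj
    have := hxy.symm.trans hxy'
    simp only [Sym2.eq_iff, Sum.inl.injEq, Sum.inr.injEq, reduceCtorEq, and_false, or_false]
      at this
    rw [this.1, this.2]
  · rintro i - u hu v hv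
    obtain ⟨z, hz⟩ := h i (fromEdgeSet {e | ∃ x y, col x y = i ∧ e = s(.inl x, .inr y)})
      fun x y hxy => (fromEdgeSet_adj _).2 ⟨⟨x, y, hxy, rfl⟩, by simp⟩
    exact (hz u hu).symm.trans (hz v hv)

variable {l : ℕ}

theorem hasEdgeDisjointTrees_inr_inr_inr (a b c : Fin (l + 1)) :
    HasEdgeDisjointTrees (completeBipartiteGraph (Fin l) (Fin (l + 1)))
      {.inr a, .inr b, .inr c} l := by
  have := hasEdgeDisjointTrees_of_biColoring (S := {.inr a, .inr b, .inr c})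
    ⟨.inr a, by simp⟩ (fun (x : Fin l) (_ : Fin (l + 1)) => x) fun i H hH => ⟨.inl i, ?_⟩
  · simpa using this
  · intro u hu
    simp only [mem_insert, mem_singleton] at hu
    obtain rfl | rfl | rfl := hu <;> exact (hH _ _ rfl).reachable

theorem hasEdgeDisjointTrees_inl_inl_inl (a b c : Fin l) :
    HasEdgeDisjointTrees (completeBipartiteGraph (Fin l) (Fin (l + 1)))
      {.inl a, .inl b, .inl c} l := by
  have : Nonempty (Fin l) := ⟨a⟩
  obtain ⟨ψ, hψ⟩ := (Fin.succAbove_right_injective (p := (0 : Fin (l + 1)))).hasLeftInverse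
  have := hasEdgeDisjointTrees_of_biColoring (S := {.inl a, .inl b, .inl c})
    ⟨.inl a, by simp⟩ (fun (_ : Fin l) (y : Fin (l + 1)) => ψ y) fun i H hH =>
      ⟨.inr (Fin.succAbove 0 i), ?_⟩
  · simpa using this
  · intro u hu
    simp only [mem_insert, mem_singleton] at hu
    obtain rfl | rfl | rfl := hu <;> exact (hH _ _ (hψ i)).symm.reachable

/-- The `l` right vertices other than `a` carry full stars, and the `i`-th star is extended to `a`
through the left vertex `i`. -/
theorem hasEdgeDisjointTrees_inr_inl_inl (a : Fin (l + 1)) (b c : Fin l) :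
    HasEdgeDisjointTrees (completeBipartiteGraph (Fin l) (Fin (l + 1)))
      {.inr a, .inl b, .inl c} l := by
  have : Nonempty (Fin l) := ⟨b⟩
  obtain ⟨ψ, hψ⟩ := (Fin.succAbove_right_injective (p := a)).hasLeftInverse
  have := hasEdgeDisjointTrees_of_biColoring (S := {.inr a, .inl b, .inl c})
    ⟨.inr a, by simp⟩ (fun (x : Fin l) (y : Fin (l + 1)) => if y = a then x else ψ y)
    fun i H hH => ⟨.inr (a.succAbove i), ?_⟩
  · simpa using this
  · have hx : ∀ x, H.Adj (.inr (a.succAbove i)) (.inl x) := fun x =>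
      (hH _ _ (by rw [if_neg (Fin.succAbove_ne a i), hψ i])).symm
    intro u hu
    simp only [mem_insert, mem_singleton] at hu
    obtain rfl | rfl | rfl := hu
    · exact (hx i).reachable.trans (hH _ _ (if_pos rfl)).reachable
    · exact (hx b).reachable
    · exact (hx c).reachable

/-- The tree of a left vertex `i ≠ a` joins `i` to `b` and `c`, and reaches `a` through a private
right vertex `φ i ≠ b`. Choosing `φ a = c` leaves `ab` and `ac` for the tree of `a`. -/
theorem hasEdgeDisjointTrees_inl_inr_inr (a : Fin l) {b c : Fin (l + 1)} (hbc : b ≠ c) :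
    HasEdgeDisjointTrees (completeBipartiteGraph (Fin l) (Fin (l + 1)))
      {.inl a, .inr b, .inr c} l := by
  have : Nonempty (Fin l) := ⟨a⟩
  obtain ⟨z, hz⟩ := Fin.exists_succAbove_eq hbc.symm
  set φ : Fin l → Fin (l + 1) := fun x => b.succAbove (Equiv.swap a z x) with hφ
  have hinj : Function.Injective φ :=
    Fin.succAbove_right_injective.comp (Equiv.swap a z).injective
  have hφa : φ a = c := by simp [hφ, hz]
  have hφb : ∀ x, φ x ≠ b := fun x => Fin.succAbove_ne _ _
  obtain ⟨ψ, hψ⟩ := hinj.hasLeftInverse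
  have := hasEdgeDisjointTrees_of_biColoring (S := {.inl a, .inr b, .inr c})
    ⟨.inl a, by simp⟩ (fun (x : Fin l) (y : Fin (l + 1)) =>
      if x = a then (if y = b then a else ψ y) else x)
    fun i H hH => ⟨.inl i, ?_⟩
  · simpa using this
  · have hb : H.Adj (.inl i) (.inr b) := hH _ _ (by split_ifs <;> simp_all)
    have hc : H.Adj (.inl i) (.inr c) := hH _ _ (by
      split_ifs with h1 h2
      · exact absurd h2 hbc.symm
      · rw [h1, ← hφa, hψ a]
      · rfl)
    have ha : H.Adj (.inl a) (.inr (φ i)) := hH _ _ (by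
      rw [if_pos rfl, if_neg (hφb i), hψ i])
    intro u hu
    simp only [mem_insert, mem_singleton] at hu
    obtain rfl | rfl | rfl := hu
    · by_cases h : i = a
      · rw [h]
      · exact (hH i (φ i) (if_neg h)).reachable.trans ha.symm.reachable
    · exact hb.reachable
    · exact hc.reachable

theorem le_genEdgeConn_completeBipartite (hl : 1 ≤ l) :
    l ≤ genEdgeConn (completeBipartiteGraph (Fin l) (Fin (l + 1))) 3 := by
  rw [le_genEdgeConn_iff (by norm_num) (by simp; lia)]
  intro S hS
  obtain ⟨a, b, c, hab, hac, hbc, rfl⟩ := card_eq_three.1 hS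
  rcases a with a | a <;> rcases b with b | b <;> rcases c with c | c
  · exact hasEdgeDisjointTrees_inl_inl_inl a b c
  · rw [insert_comm_right, insert_comm_left]
    exact hasEdgeDisjointTrees_inr_inl_inl c a b
  · rw [insert_comm_left]
    exact hasEdgeDisjointTrees_inr_inl_inl b a c
  · exact hasEdgeDisjointTrees_inl_inr_inr a (by simpa using hbc)
  · exact hasEdgeDisjointTrees_inr_inl_inl a b c
  · rw [insert_comm_left]
    exact hasEdgeDisjointTrees_inl_inr_inr b (by simpa using hac)
  · rw [insert_comm_right, insert_comm_left]
    exact hasEdgeDisjointTrees_inl_inr_inr c (by simpa using hab)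
  · exact hasEdgeDisjointTrees_inr_inr_inr a b c

theorem ncard_edgeSet_completeBipartite (m n : ℕ) :
    (completeBipartiteGraph (Fin m) (Fin n)).edgeSet.ncard = m * n := by
  have hinj : Function.Injective fun p : Fin m × Fin n =>
      (s(.inl p.1, .inr p.2) : Sym2 (Fin m ⊕ Fin n)) := by
    rintro ⟨x, y⟩ ⟨x', y'⟩ h
    simpa [Sym2.eq_iff] using h
  have hr : (completeBipartiteGraph (Fin m) (Fin n)).edgeSet =
      Set.range fun p : Fin m × Fin n => (s(.inl p.1, .inr p.2) : Sym2 (Fin m ⊕ Fin n)) := by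
    ext e
    induction e using Sym2.ind with
    | _ u v => rcases u with u | u <;> rcases v with v | v <;> simp
  rw [hr, ← Set.image_univ, Set.ncard_image_of_injective _ hinj, Set.ncard_univ]
  simp

theorem genEdgeConn_completeBipartite (hl : 1 ≤ l) :
    genEdgeConn (completeBipartiteGraph (Fin l) (Fin (l + 1))) 3 = l := by
  refine le_antisymm ?_ (le_genEdgeConn_completeBipartite hl)
  by_contra! h
  -- With `l + 1` trees this would give `(l+2)(2l+1) ≤ (2l+3)l` after cancelling `l + 1`, which is
  -- false.
  have := le_edges_of_le_genEdgeConn (completeBipartiteGraph (Fin l) (Fin (l + 1)))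
    (by simp; lia) (Nat.succ_le_of_lt h)
  rw [ncard_edgeSet_completeBipartite] at this
  simp only [Fintype.card_sum, Fintype.card_fin] at this
  nlinarith

end Bipartite
-- The values of `minSize`
theorem exists_genEdgeConn_three_eq {n m : ℕ} (hn : 3 ≤ n) (hm : m ≤ n - 2) :
    ∃ G : SimpleGraph (Fin n), genEdgeConn G 3 = m :=
  exists_genEdgeConn_eq (nearComplete n) (by norm_num) (by simpa using hn)
    (hm.trans (le_genEdgeConn_nearComplete hn))

theorem one_le_genEdgeConn_iff_connected {V : Type*} [Fintype V] (G : SimpleGraph V)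
    (hV : 3 ≤ Fintype.card V) : 1 ≤ genEdgeConn G 3 ↔ G.Connected := by
  classical
  constructor
  · intro h
    have : Nonempty V := Fintype.card_pos_iff.1 (by lia)
    refine ⟨fun u v => ?_⟩
    rcases eq_or_ne u v with rfl | huv
    · exact Reachable.refl _
    · obtain ⟨w, hw, hw'⟩ := exists_ne_ne hV u v
      obtain ⟨H, h1, -, h3⟩ := (HasEdgeDisjointTrees.of_le_genEdgeConn hV h huv hw.symm
        hw'.symm).exists_subgraphs
      exact (h3 0 u (by simp) v (by simp)).mono (h1 0)
  · intro h
    rw [le_genEdgeConn_iff (by norm_num) hV]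
    intro S hS
    simpa using hasEdgeDisjointTrees_of_subgraphs (Finset.card_pos.1 (by lia)) {()} (fun _ => G)
      (fun _ _ => le_rfl) (fun _ _ _ _ _ _ _ _ => rfl)
      (fun _ _ u _ v _ => h.preconnected u v)

theorem minSize_three_one {n : ℕ} (hn : 3 ≤ n) : minSize n 3 1 = n - 1 := by
  have hV : 3 ≤ Fintype.card (Fin n) := by simpa using hn
  apply le_antisymm
  · have : Nonempty (Fin n) := ⟨⟨0, by lia⟩⟩
    obtain ⟨T, -, hT⟩ := (connected_top (V := Fin n)).exists_isTree_le
    have hcard : T.edgeSet.ncard + 1 = n := by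
      classical
      simpa [ncard_edgeSet_eq] using hT.card_edgeFinset
    have h1 := (one_le_genEdgeConn_iff_connected T hV).2 hT.connected
    have h2 : genEdgeConn T 3 ≤ 1 := by
      by_contra! h
      -- Two disjoint trees for every triple would need `6n ≤ 5(n - 1)`.
      have := le_edges_of_le_genEdgeConn T hV (Nat.succ_le_of_lt h)
      rw [Fintype.card_fin] at this
      lia
    have := minSize_le (k := 3) T
    rw [le_antisymm h2 h1] at this
    lia
  · refine le_minSize (exists_genEdgeConn_three_eq hn (by lia)) fun G hG => ?_
    have := ((one_le_genEdgeConn_iff_connected G hV).1 hG.ge).card_vert_le_card_edgeSet_add_one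
    rw [Nat.card_eq_fintype_card, Fintype.card_fin] at this
    have h : Nat.card G.edgeSet = G.edgeSet.ncard := rfl
    lia

theorem minSize_three_sub_two {n : ℕ} (hn : 3 ≤ n) :
    minSize n 3 (n - 2) = n.choose 2 - 1 := by
  have hV : 3 ≤ Fintype.card (Fin n) := by simpa using hn
  apply le_antisymm
  · have h1 := genEdgeConn_three_le (nearComplete n) hV
    have h2 := le_genEdgeConn_nearComplete hn
    rw [Fintype.card_fin] at h1
    have h3 := minSize_le (k := 3) (nearComplete n)
    rw [le_antisymm h1 h2] at h3
    have h4 := ncard_edgeSet_add_compl (nearComplete n)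
    rw [Fintype.card_fin] at h4
    have h5 : 0 < (nearComplete n)ᶜ.edgeSet.ncard := by
      rw [Set.ncard_pos]
      exact ⟨s(⟨0, by lia⟩, ⟨1, by lia⟩), by simp [compl_adj]⟩
    lia
  · refine le_minSize (exists_genEdgeConn_three_eq hn le_rfl) fun G hG => ?_
    have h1 := ncard_compl_le_one G hV (by rw [hG, Fintype.card_fin])
    have h2 := ncard_edgeSet_add_compl G
    rw [Fintype.card_fin] at h2
    lia

theorem minSize_three_sub_three {n : ℕ} (hn : 3 ≤ n) :
    minSize n 3 (n - 3) = n.choose 2 - (n + 3) / 2 := by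
  have hV : 3 ≤ Fintype.card (Fin n) := by simpa using hn
  apply le_antisymm
  · have h1 := genEdgeConn_three_le (sparseDeletion n) hV
    have h2 := le_genEdgeConn_sparseDeletion hn
    have h3 := le_ncard_compl_sparseDeletion hn
    have h4 : genEdgeConn (sparseDeletion n) 3 ≤ n - 3 := by
      by_contra! h
      -- A value of `n - 2` allows one missing edge, but at least three are missing.
      have := ncard_compl_le_one (sparseDeletion n) hV (by rw [Fintype.card_fin]; lia)
      lia
    have h5 := minSize_le (k := 3) (sparseDeletion n)
    rw [le_antisymm h4 h2] at h5
    have h6 := ncard_edgeSet_add_compl (sparseDeletion n)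
    rw [Fintype.card_fin] at h6
    lia
  · refine le_minSize (exists_genEdgeConn_three_eq hn (by lia)) fun G hG => ?_
    have h1 := two_mul_ncard_compl_le G hV (by rw [hG, Fintype.card_fin])
    have h2 := ncard_edgeSet_add_compl G
    rw [Fintype.card_fin] at h1 h2
    lia

/-- The range `l ≤ n - 2` also covers `n = 2l + 1` for every `l ≥ 1`, as sharpness requires. -/
theorem ceil_le_minSize_three {n l : ℕ} (hn : 3 ≤ n) (hl : l ≤ n - 2) :
    ⌈((l : ℚ) * ((l : ℚ) + 1) / (2 * (l : ℚ) + 1)) * (n : ℚ)⌉₊ ≤ minSize n 3 l := by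
  refine le_minSize (exists_genEdgeConn_three_eq hn hl) fun G hG => ?_
  have h := le_edges_of_le_genEdgeConn G (by simpa using hn) hG.ge
  rw [Fintype.card_fin] at h
  rw [Nat.ceil_le, div_mul_eq_mul_div, div_le_iff₀ (by positivity)]
  have h' : ((l * (l + 1) * n : ℕ) : ℚ) ≤ ((2 * l + 1) * G.edgeSet.ncard : ℕ) := by
    exact_mod_cast h
  push_cast at h'
  linarith

theorem ceil_two_mul_add_one (l : ℕ) :
    ⌈((l : ℚ) * ((l : ℚ) + 1) / (2 * (l : ℚ) + 1)) * ((2 * l + 1 : ℕ) : ℚ)⌉₊ = l * (l + 1) := by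
  have h : ((l : ℚ) * ((l : ℚ) + 1) / (2 * (l : ℚ) + 1)) * ((2 * l + 1 : ℕ) : ℚ) =
      ((l * (l + 1) : ℕ) : ℚ) := by
    push_cast
    field_simp
  rw [h, Nat.ceil_natCast]

theorem minSize_two_mul_add_one_le {l : ℕ} (hl : 1 ≤ l) :
    minSize (2 * l + 1) 3 l ≤ l * (l + 1) := by
  classical
  set K := completeBipartiteGraph (Fin l) (Fin (l + 1)) with hK
  have hcard : Fintype.card (Fin l ⊕ Fin (l + 1)) = 2 * l + 1 := by simp; lia
  let e := K.overFinIso hcard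
  have h := minSize_le (k := 3) (K.overFin hcard)
  rwa [← genEdgeConn_congr e (by norm_num) (by lia), genEdgeConn_completeBipartite hl,
    ncard_edgeSet_eq, ← e.card_edgeFinset_eq, ← ncard_edgeSet_eq,
    ncard_edgeSet_completeBipartite] at h

end GenEdgeConn

theorem mainTheorem2 :
    (∀ n : ℕ, 3 ≤ n →
      GenEdgeConn.minSize n 3 (n - 2) = n.choose 2 - 1 ∧
      GenEdgeConn.minSize n 3 (n - 3) = n.choose 2 - (n + 3) / 2 ∧
      GenEdgeConn.minSize n 3 1 = n - 1 ∧
      (11 ≤ n → ∀ ℓ : ℕ, 1 ≤ ℓ → ℓ ≤ n - 4 →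
        ⌈((ℓ : ℚ) * ((ℓ : ℚ) + 1) / (2 * (ℓ : ℚ) + 1)) * (n : ℚ)⌉₊ ≤
          GenEdgeConn.minSize n 3 ℓ)) ∧
    (∀ ℓ : ℕ, 1 ≤ ℓ →
      GenEdgeConn.genEdgeConn (completeBipartiteGraph (Fin ℓ) (Fin (ℓ + 1))) 3 = ℓ ∧
      (completeBipartiteGraph (Fin ℓ) (Fin (ℓ + 1))).edgeSet.ncard =
        ⌈((ℓ : ℚ) * ((ℓ : ℚ) + 1) / (2 * (ℓ : ℚ) + 1)) * ((2 * ℓ + 1 : ℕ) : ℚ)⌉₊ ∧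
      GenEdgeConn.minSize (2 * ℓ + 1) 3 ℓ =
        ⌈((ℓ : ℚ) * ((ℓ : ℚ) + 1) / (2 * (ℓ : ℚ) + 1)) * ((2 * ℓ + 1 : ℕ) : ℚ)⌉₊) := by
  refine ⟨fun n hn => ⟨GenEdgeConn.minSize_three_sub_two hn, GenEdgeConn.minSize_three_sub_three hn,
    GenEdgeConn.minSize_three_one hn, fun _ l _ hl =>
      GenEdgeConn.ceil_le_minSize_three hn (by lia)⟩, fun l hl => ⟨
    GenEdgeConn.genEdgeConn_completeBipartite hl, ?_, le_antisymm ?_ ?_⟩⟩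
  · rw [GenEdgeConn.ncard_edgeSet_completeBipartite,
      GenEdgeConn.ceil_two_mul_add_one]
  · rw [GenEdgeConn.ceil_two_mul_add_one]
    exact GenEdgeConn.minSize_two_mul_add_one_le hl
  · exact GenEdgeConn.ceil_le_minSize_three (by lia) (by lia)
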